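/- Let $a<0$ and $-\tfrac14a^2<c<0$, and let $r:\mathbb R\to\mathbb R$ be a $C^2$ solution of $r''+2r^3+ar=0$ with $r'^2+r^4+ar^2=c$ (so $r$ is non-constant, periodic and has no zeros). Let $T>0$ be the least positive period of $r$, let $\omega\ne0$ satisfy $\omega T\in2\pi\mathbb Z$, and put $$\varphi(x,t)=e^{i\omega(x+(3a+\omega^2)t)}\,r(x+(a+3\omega^2)t),$$ a $T$-periodic travelling wave of the complex modified Korteweg–de Vries equation $$u_t+6|u|^2u_x+u_{xxx}=0. \qquad (1)$$ For a $T$-periodic $C^1$ function $f$ of $x$ let $$Q(f)=i\int_0^T\overline{f_x}\,f\,dx,\quad P(f)=\int_0^T|f|^2dx,\quad F(f)=\int_0^T\left(|f_x|^2-|f|^4\right)dx,$$ $$M(f)=F(f)+(\omega^2-a)P(f)-2\omega Q(f),$$ and, for $q>0$ and a function $u(x,t)$ that is $T$-periodic in $x$, define $d_q(u,\varphi)\ge 0$, a function of $t$, by $$d_q^2(u,\varphi)=\inf_{(\eta,\xi)\in\mathbb R^2}\left(\|u_x(\cdot,t)-e^{i\omega\eta}\varphi_x(\cdot-\xi,t)\|^2+q\,\|u(\cdot,t)-e^{i\omega\eta}\varphi(\cdot-\xi,t)\|^2\right),$$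 where $\|\cdot\|$ is the norm of $L^2[0,T]$. Then there are constants $m,q,\delta_0>0$ such that the following holds for all $s>\tfrac32$ and $t_0>0$, for every $T$-periodic (in $x$) solution $u\in C([0,t_0);H^s[0,T])\cap C^1([0,t_0);H^{s-3}[0,T])$ of (1), where $H^s[0,T]$ denotes the $T$-periodic Sobolev space, and for every $t\in[0,t_0)$: if $P(u(\cdot,t))=P(\varphi(\cdot,t))$ and $d_q(u,\varphi)<\delta_0$ at time $t$, then at that time $$M(u)-M(\varphi)\ \ge\ m\,d_q^2(u,\varphi).$$ -/

import Mathlib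

open Set

noncomputable section

namespace CMKdV

/-- `H(r, r') = c` on a left or right orbit of the Duffing oscillator: `r` is a real solution of
`r'' + 2 r³ + a r = 0` at energy level `c`, with least positive period `T`.  (For `a < 0` and
`-a²/4 < c < 0`, the level set of the energy consists exactly of these two orbits.) -/
structure IsProfile (a c T : ℝ) (r : ℝ → ℝ) : Prop where
  contDiff : ContDiff ℝ 2 r
  ode : ∀ y, deriv (deriv r) y + 2 * r y ^ 3 + a * r y = 0
  energy : ∀ y, deriv r y ^ 2 + r y ^ 4 + a * r y ^ 2 = c
  least_period : IsLeast {τ : ℝ | 0 < τ ∧ Function.Periodic r τ} T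

/-- The travelling wave `φ(x,t) = e^{iω(x + (3a+ω²)t)} r(x + (a+3ω²)t)`.
Time is the first argument of all space-time functions, so that `wave a ω r t` is the function
`φ(·,t)` of `x`. -/
def wave (a ω : ℝ) (r : ℝ → ℝ) (t x : ℝ) : ℂ :=
  Complex.exp (Complex.I * ω * (x + (3 * a + ω ^ 2) * t : ℝ)) * (r (x + (a + 3 * ω ^ 2) * t) : ℂ)

/-- `Q(f) = i ∫₀ᵀ conj(f_x) f dx`.  For `T`-periodic `C¹` functions the right-hand side is a real
number (integrate by parts), so taking the real part only changes its type. -/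
def Q (T : ℝ) (f : ℝ → ℂ) : ℝ :=
  (Complex.I * ∫ x in (0 : ℝ)..T, (starRingEnd ℂ) (deriv f x) * f x).re

/-- `P(f) = ∫₀ᵀ |f|² dx`. -/
def P (T : ℝ) (f : ℝ → ℂ) : ℝ := ∫ x in (0 : ℝ)..T, ‖f x‖ ^ 2

/-- `F(f) = ∫₀ᵀ (|f_x|² - |f|⁴) dx`. -/
def F (T : ℝ) (f : ℝ → ℂ) : ℝ := ∫ x in (0 : ℝ)..T, (‖deriv f x‖ ^ 2 - ‖f x‖ ^ 4)

/-- `M = F + (ω² - a) P - 2 ω Q`. -/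
def M (a ω T : ℝ) (f : ℝ → ℂ) : ℝ := F T f + (ω ^ 2 - a) * P T f - 2 * ω * Q T f

/-- `d_q(f, g)`, the square root of
`inf_{η,ξ} (‖f' - e^{iωη} g'(· - ξ)‖² + q ‖f - e^{iωη} g(· - ξ)‖²)`, norms in `L²[0,T]`. -/
def dq (q ω T : ℝ) (f g : ℝ → ℂ) : ℝ :=
  Real.sqrt (⨅ p : ℝ × ℝ,
    ((∫ x in (0 : ℝ)..T,
        ‖deriv f x - Complex.exp (Complex.I * ω * p.1) * deriv g (x - p.2)‖ ^ 2)
      + q * ∫ x in (0 : ℝ)..T, ‖f x - Complex.exp (Complex.I * ω * p.1) * g (x - p.2)‖ ^ 2))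

/-- Weighted Fourier coefficient `(1+n²)^{s/2} f̂(n)`; the periodic Sobolev space `H^s` is
isometric to `ℓ²(ℤ)` through the sequences `(1+n²)^{s/2} f̂(n)`. -/
def weighted (s : ℝ) (coeff : ℤ → ℂ) (n : ℤ) : ℂ :=
  ((1 + (n : ℝ) ^ 2) ^ (s / 2) : ℝ) * coeff n

/-- The `n`-th Fourier coefficient of `-6|f|² f_x - f_xxx` for a `T`-periodic function `f`
(the term `f_xxx` is taken in the sense of periodic distributions). -/
def rhsCoeff {T : ℝ} (hT : 0 < T) (f : ℝ → ℂ) (n : ℤ) : ℂ :=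
  -fourierCoeffOn hT (fun x => 6 * (‖f x‖ ^ 2 : ℝ) * deriv f x) n
    - (2 * Real.pi * Complex.I * n / T) ^ 3 * fourierCoeffOn hT f n

/-- `u` is a solution of `u_t + 6|u|² u_x + u_xxx = 0`, of period `T` in `x`, in the class
`C([0,t₀); H^s) ∩ C¹([0,t₀); H^{s-3})`, used for `s > 3/2`.  Elements of `H^s` are then `C¹`
functions, represented here by their continuous representatives.  `U`, `W` are the curve `u`
regarded in `H^s` and in `H^{s-3}`, and `V` is its time derivative in `H^{s-3}`. -/
structure IsSolution {T : ℝ} (hT : 0 < T) (s t₀ : ℝ) (u : ℝ → ℝ → ℂ) : Prop where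
  periodic : ∀ t ∈ Ico 0 t₀, Function.Periodic (u t) T
  continuous : ∀ t ∈ Ico 0 t₀, Continuous (u t)
  continuous_curve : ∃ U : ℝ → lp (fun _ : ℤ => ℂ) 2,
    (∀ t ∈ Ico 0 t₀, ∀ n, U t n = weighted s (fourierCoeffOn hT (u t)) n) ∧
    ContinuousOn U (Ico 0 t₀)
  equation : ∃ W V : ℝ → lp (fun _ : ℤ => ℂ) 2,
    (∀ t ∈ Ico 0 t₀, ∀ n, W t n = weighted (s - 3) (fourierCoeffOn hT (u t)) n) ∧
    (∀ t ∈ Ico 0 t₀, HasDerivWithinAt W (V t) (Ico 0 t₀) t) ∧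
    ContinuousOn V (Ico 0 t₀) ∧
    (∀ t ∈ Ico 0 t₀, ∀ n, V t n = weighted (s - 3) (rhsCoeff hT (u t)) n)

end CMKdV

end

/-!
# Orbital coercivity for dnoidal travelling waves

Writing `f = e^{iωx} g` turns `M(f)` into `E(g) = ∫ (|g'|² - |g|⁴ - a |g|²)`, and the wave into the
orbit of the real profile `r` under phases and translations, so `r` has to be shown to be a
nondegenerate local minimum of `E` at fixed mass, modulo these symmetries. Choosing the phase and
the translation that bring `g` closest to `r` in `L²` (`IsProfile.exists_modulation`) gives
`g = r + h + i k` with `h ⊥ r'` and `k ⊥ r`; equality of the masses makes `⟨r, h⟩` quadratically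
small. The second variation of `E` is `⟨L₊ h, h⟩ + ⟨L₋ k, k⟩`, with `L₊ = -∂² - a - 6 r²` and
`L₋ = -∂² - a - 2 r²`, and the remainder is small compared with the `H¹` norm as soon as `h`, `k`
are small in `L²` (`IsProfile.exists_energy_lower_bound`).

* `L₋ r = 0` and `r` has no zeros, so `⟨L₋ k, k⟩ = ∫ r² ((k/r)')²`, which is coercive on `r^⊥`
  (`IsProfile.exists_coercive_imag`).
* `L₊` has the eigenfunctions `r² + κ₀`, `r'`, `r² + κ₂` with eigenvalues `l₀ < 0 < l₂` and `0` in
  the middle. Jacobi's argument on the nodal intervals of `r² + κ₂` shows that the form of `L₊` is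
  at least `l₂` on the orthogonal complement of the first two
  (`IsProfile.schrForm_ge_of_orthogonal`). That there are only two nodal intervals in a period uses
  that `T` is the least period.
* There is an explicit periodic `ψ` with `L₊ ψ = r` (`IsProfile.invProfile`), and
  `⟨r, ψ⟩ = -(T/2) (c + μ²) / (4 c - 2 a μ)`, where `μ` is the mean of `r²`. Since `(r'/r)'` has
  mean zero, `μ > √(-c)`, whence `⟨r, ψ⟩ < 0`. So the constraint `h ⊥ r` removes the
  negative direction of `L₊` (`exists_coercive_of_index_one`).
-/

namespace CMKdV

/-! ### Quadratic forms on periodic functions -/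

/-- The space of `T`-periodic `C¹` functions `ℝ → ℝ`. -/
def PerC1 (T : ℝ) : Submodule ℝ (ℝ → ℝ) where
  carrier := {f | ContDiff ℝ 1 f ∧ Function.Periodic f T}
  add_mem' hf hg := ⟨hf.1.add hg.1, hf.2.add hg.2⟩
  zero_mem' := ⟨contDiff_const, fun _ => rfl⟩
  smul_mem' c f hf := ⟨contDiff_const.smul hf.1, fun x => by simp [hf.2 x]⟩

namespace PerC1

variable {T : ℝ}

lemma contDiff (f : PerC1 T) : ContDiff ℝ 1 f.1 := f.2.1

lemma periodic (f : PerC1 T) : Function.Periodic f.1 T := f.2.2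

lemma continuous (f : PerC1 T) : Continuous f.1 := (PerC1.contDiff f).continuous

lemma continuous_deriv (f : PerC1 T) : Continuous (deriv f.1) :=
  (PerC1.contDiff f).continuous_deriv le_rfl

lemma differentiable (f : PerC1 T) : Differentiable ℝ f.1 :=
  (PerC1.contDiff f).differentiable one_ne_zero

lemma periodic_deriv (f : PerC1 T) : Function.Periodic (deriv f.1) T := fun x => by
  rw [← deriv_comp_add_const, show (fun x => f.1 (x + T)) = f.1 from funext (periodic f)]

lemma deriv_add (f g : PerC1 T) (x : ℝ) : deriv (f.1 + g.1) x = deriv f.1 x + deriv g.1 x :=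
  _root_.deriv_add (PerC1.differentiable f x) (PerC1.differentiable g x)

lemma deriv_smul (c : ℝ) (f : PerC1 T) (x : ℝ) : deriv (c • f.1) x = c * deriv f.1 x := by
  simpa using deriv_const_smul c (PerC1.differentiable f x)

end PerC1

/-- The `L²[0,T]` inner product on periodic functions. -/
noncomputable def l2Form (T : ℝ) : PerC1 T →ₗ[ℝ] PerC1 T →ₗ[ℝ] ℝ :=
  LinearMap.mk₂ ℝ (fun h k => ∫ x in (0 : ℝ)..T, h.1 x * k.1 x)
    (fun f g k => by
      have := PerC1.continuous f; have := PerC1.continuous g; have := PerC1.continuous k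
      rw [← intervalIntegral.integral_add (Continuous.intervalIntegrable (by fun_prop) _ _)
        (Continuous.intervalIntegrable (by fun_prop) _ _)]
      exact intervalIntegral.integral_congr fun x _ => by simp [add_mul])
    (fun c f k => by
      rw [smul_eq_mul, ← intervalIntegral.integral_const_mul]
      exact intervalIntegral.integral_congr fun x _ => by simp [mul_assoc])
    (fun f g k => by
      have := PerC1.continuous f; have := PerC1.continuous g; have := PerC1.continuous k
      rw [← intervalIntegral.integral_add (Continuous.intervalIntegrable (by fun_prop) _ _)
        (Continuous.intervalIntegrable (by fun_prop) _ _)]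
      exact intervalIntegral.integral_congr fun x _ => by simp [mul_add])
    (fun c f k => by
      rw [smul_eq_mul, ← intervalIntegral.integral_const_mul]
      exact intervalIntegral.integral_congr fun x _ => by simp [mul_left_comm])

lemma l2Form_apply {T : ℝ} (h k : PerC1 T) :
    l2Form T h k = ∫ x in (0 : ℝ)..T, h.1 x * k.1 x := rfl

lemma l2Form_comm {T : ℝ} (h k : PerC1 T) : l2Form T h k = l2Form T k h := by
  simp only [l2Form_apply, mul_comm]

/-- The bilinear form `⟨(-∂² - W) h, k⟩` of a Schrödinger operator on periodic functions, written
as `∫₀ᵀ (h' k' - W h k)` so that it makes sense for `C¹` functions. -/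
noncomputable def schrForm (T : ℝ) (W : C(ℝ, ℝ)) : PerC1 T →ₗ[ℝ] PerC1 T →ₗ[ℝ] ℝ :=
  LinearMap.mk₂ ℝ (fun h k => ∫ x in (0 : ℝ)..T, (deriv h.1 x * deriv k.1 x - W x * h.1 x * k.1 x))
    (fun f g k => by
      have := PerC1.continuous f; have := PerC1.continuous g; have := PerC1.continuous k
      have := PerC1.continuous_deriv f; have := PerC1.continuous_deriv g
      have := PerC1.continuous_deriv k
      rw [← intervalIntegral.integral_add (Continuous.intervalIntegrable (by fun_prop) _ _)
        (Continuous.intervalIntegrable (by fun_prop) _ _)]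
      exact intervalIntegral.integral_congr fun x _ => by
        simp only [PerC1.deriv_add, Submodule.coe_add, Pi.add_apply]; ring)
    (fun c f k => by
      rw [smul_eq_mul, ← intervalIntegral.integral_const_mul]
      exact intervalIntegral.integral_congr fun x _ => by
        simp only [PerC1.deriv_smul, Submodule.coe_smul, Pi.smul_apply, smul_eq_mul]; ring)
    (fun f g k => by
      have := PerC1.continuous f; have := PerC1.continuous g; have := PerC1.continuous k
      have := PerC1.continuous_deriv f; have := PerC1.continuous_deriv g
      have := PerC1.continuous_deriv k
      rw [← intervalIntegral.integral_add (Continuous.intervalIntegrable (by fun_prop) _ _)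
        (Continuous.intervalIntegrable (by fun_prop) _ _)]
      exact intervalIntegral.integral_congr fun x _ => by
        simp only [PerC1.deriv_add, Submodule.coe_add, Pi.add_apply]; ring)
    (fun c f k => by
      rw [smul_eq_mul, ← intervalIntegral.integral_const_mul]
      exact intervalIntegral.integral_congr fun x _ => by
        simp only [PerC1.deriv_smul, Submodule.coe_smul, Pi.smul_apply, smul_eq_mul]; ring)

lemma schrForm_apply {T : ℝ} (W : C(ℝ, ℝ)) (h k : PerC1 T) :
    schrForm T W h k =
      ∫ x in (0 : ℝ)..T, (deriv h.1 x * deriv k.1 x - W x * h.1 x * k.1 x) := rfl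

lemma schrForm_comm {T : ℝ} (W : C(ℝ, ℝ)) (h k : PerC1 T) :
    schrForm T W h k = schrForm T W k h := by
  simp only [schrForm_apply]
  exact intervalIntegral.integral_congr fun x _ => by ring

/-- The integral over a period of the derivative of a periodic function vanishes. -/
lemma integral_deriv_eq_zero_of_periodic {T : ℝ} {f f' : ℝ → ℝ} (hf : ∀ x, HasDerivAt f (f' x) x)
    (hf' : Continuous f') (hp : Function.Periodic f T) : ∫ x in (0 : ℝ)..T, f' x = 0 := by
  rw [intervalIntegral.integral_eq_sub_of_hasDerivAt (fun x _ => hf x)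
    (hf'.intervalIntegrable _ _)]
  have := hp 0
  rw [zero_add] at this
  rw [this, sub_self]

/-- On `C²` functions, `schrForm` is given by the operator `-∂² - W`. -/
lemma schrForm_eq_integral {T : ℝ} (W : C(ℝ, ℝ)) (h : PerC1 T) {h₁ h₂ f : ℝ → ℝ}
    (hh₁ : ∀ x, HasDerivAt h.1 (h₁ x) x) (hh₂ : ∀ x, HasDerivAt h₁ (h₂ x) x)
    (hc : Continuous h₂) (hf : ∀ x, -h₂ x - W x * h.1 x = f x) (v : PerC1 T) :
    schrForm T W h v = ∫ x in (0 : ℝ)..T, f x * v.1 x := by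
  have e1 : deriv h.1 = h₁ := funext fun x => (hh₁ x).deriv
  have hc1 : Continuous h₁ := e1 ▸ (PerC1.continuous_deriv h)
  have hp1 : Function.Periodic h₁ T := e1 ▸ PerC1.periodic_deriv h
  have := PerC1.continuous v; have := PerC1.continuous_deriv v; have := PerC1.continuous h
  have key := integral_deriv_eq_zero_of_periodic (T := T) (f := fun x => h₁ x * v.1 x)
    (f' := fun x => h₂ x * v.1 x + h₁ x * deriv v.1 x)
    (fun x => (hh₂ x).mul (PerC1.differentiable v x).hasDerivAt) (by fun_prop)
    (hp1.mul (PerC1.periodic v))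
  have hfc : Continuous f := by
    rw [← funext hf]; fun_prop
  have e2 : (∫ x in (0 : ℝ)..T, (h₂ x * v.1 x + h₁ x * deriv v.1 x)) + ∫ x in (0 : ℝ)..T,
      f x * v.1 x = ∫ x in (0 : ℝ)..T, (h₁ x * deriv v.1 x - W x * h.1 x * v.1 x) := by
    rw [← intervalIntegral.integral_add (Continuous.intervalIntegrable (by fun_prop) _ _)
      (Continuous.intervalIntegrable (by fun_prop) _ _)]
    exact intervalIntegral.integral_congr fun x _ => by
      simp only [← hf]; ring
  rw [schrForm_apply, e1, ← e2, key, zero_add]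

/-! ### Coercivity of forms with one negative direction -/

/-- A symmetric form `B` with one negative direction `χ` and one null direction `d`, whose operator
is `L`, is positive on the complement of `d` and `ρ = L ψ` if `⟨ρ, ψ⟩ < 0`: that complement is
`B`-orthogonal to the negative vector `ψ`, as in Lorentzian geometry. -/
lemma exists_coercive_on_complement {V : Type*} [AddCommGroup V] [Module ℝ V]
    (G B : V →ₗ[ℝ] V →ₗ[ℝ] ℝ) (hG : ∀ u v, G u v = G v u) (hB : ∀ u v, B u v = B v u)
    (hG0 : ∀ v, 0 ≤ G v v) {χ d ψ ρ : V} {l₀ l₂ : ℝ} (hl₀ : l₀ < 0) (hl₂ : 0 < l₂)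
    (hχ : ∀ v, B χ v = l₀ * G χ v) (hχ0 : 0 < G χ χ) (hχd : G χ d = 0)
    (hψd : G d ψ = 0) (hψ : ∀ v, B ψ v = G ρ v) (hψ0 : G ρ ψ < 0)
    (hpos : ∀ h, G χ h = 0 → G d h = 0 → l₂ * G h h ≤ B h h) :
    ∃ m > 0, ∀ h, G d h = 0 → G ρ h = 0 → m * G h h ≤ B h h := by
  obtain ⟨σ, hσ⟩ : ∃ σ, σ = -G ρ ψ := ⟨_, rfl⟩
  have hσ0 : 0 < σ := by linarith
  obtain ⟨N, hN⟩ : ∃ N, G χ χ = N := ⟨_, rfl⟩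
  rw [hN] at hχ0
  obtain ⟨β, hβN⟩ : ∃ β, G χ ψ = β * N := ⟨G χ ψ / N, by field_simp⟩
  obtain ⟨ψ', hψ'⟩ : ∃ ψ', ψ' = ψ - β • χ := ⟨_, rfl⟩
  have hψ'χ : G χ ψ' = 0 := by simp [hψ', hβN, hN]
  have hψ'd : G d ψ' = 0 := by simp [hψ', hψd, hG d χ, hχd]
  have hψψ' : B ψ' ψ' = -σ - l₀ * N * β ^ 2 := by
    have e1 : B ψ χ = l₀ * (β * N) := by rw [hB, hχ, hβN]
    have e2 : B χ ψ = l₀ * (β * N) := by rw [hχ, hβN]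
    have e3 : B χ χ = l₀ * N := by rw [hχ, hN]
    have e4 : B ψ ψ = -σ := by rw [hψ, hσ, neg_neg]
    simp only [hψ', map_sub, map_smul, LinearMap.sub_apply, LinearMap.smul_apply, smul_eq_mul, e1,
      e2, e3, e4]
    ring
  have hψ'0 : 0 ≤ B ψ' ψ' := le_trans (mul_nonneg hl₂.le (hG0 _)) (hpos _ hψ'χ hψ'd)
  have hβ0 : 0 < -l₀ * N * β ^ 2 := by linarith
  -- By Cauchy-Schwarz, `ρ`-orthogonality costs a fraction `1 - τ < 1` of the positive part.
  obtain ⟨τ, hτ⟩ : ∃ τ, τ = σ / (-l₀ * N * β ^ 2) := ⟨_, rfl⟩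
  have hτ0 : 0 < τ := by rw [hτ]; positivity
  have hl₀' : 0 < -l₀ := by linarith
  refine ⟨min (τ / 2 * l₂) (τ / 2 * -l₀), by positivity, fun h hdh hρh => ?_⟩
  obtain ⟨α, hαN⟩ : ∃ α, G χ h = α * N := ⟨G χ h / N, by field_simp⟩
  obtain ⟨h', hh'⟩ : ∃ h', h' = h - α • χ := ⟨_, rfl⟩
  have h'χ : G χ h' = 0 := by simp [hh', hαN, hN]
  have h'd : G d h' = 0 := by simp [hh', hdh, hG d χ, hχd]
  have hh : h = h' + α • χ := by simp [hh']
  have e3 : B χ χ = l₀ * N := by rw [hχ, hN]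
  have hBh : B h h = B h' h' + l₀ * N * α ^ 2 := by
    have e1 : B h' χ = 0 := by rw [hB, hχ, h'χ, mul_zero]
    have e2 : B χ h' = 0 := by rw [hχ, h'χ, mul_zero]
    rw [hh]
    simp only [map_add, map_smul, LinearMap.add_apply, LinearMap.smul_apply, smul_eq_mul, e1, e2,
      e3]
    ring
  have hGh : G h h = G h' h' + N * α ^ 2 := by
    have e1 : G h' χ = 0 := by rw [hG, h'χ]
    rw [hh]
    simp only [map_add, map_smul, LinearMap.add_apply, LinearMap.smul_apply, smul_eq_mul, e1, h'χ,
      hN]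
    ring
  have hcross : B h' ψ' = -(l₀ * N * α * β) := by
    have e1 : B h ψ = 0 := by rw [hB, hψ, hρh]
    have e2 : B h χ = l₀ * (α * N) := by rw [hB, hχ, hαN]
    have e4 : B χ ψ = l₀ * (β * N) := by rw [hχ, hβN]
    simp only [hh', hψ', map_sub, map_smul, LinearMap.sub_apply, LinearMap.smul_apply,
      smul_eq_mul, e1, e2, e3, e4]
    ring
  -- Cauchy-Schwarz for `B` on the positive subspace
  have hCS : B h' ψ' ^ 2 ≤ B h' h' * B ψ' ψ' := by
    have hq : ∀ t : ℝ, 0 ≤ B ψ' ψ' * (t * t) + 2 * B h' ψ' * t + B h' h' := by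
      intro t
      have h1 := hpos (h' + t • ψ') (by simp [h'χ, hψ'χ]) (by simp [h'd, hψ'd])
      have h2 := le_trans (mul_nonneg hl₂.le (hG0 _)) h1
      simp only [map_add, map_smul, LinearMap.add_apply, LinearMap.smul_apply, smul_eq_mul,
        hB ψ' h'] at h2
      linarith
    have := discrim_le_zero hq
    rw [discrim] at this
    linarith
  have h'0 : l₂ * G h' h' ≤ B h' h' := hpos _ h'χ h'd
  have h'1 : 0 ≤ B h' h' := le_trans (mul_nonneg hl₂.le (hG0 _)) h'0
  have hbd : -l₀ * N * α ^ 2 ≤ B h' h' * (1 - τ) := by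
    have e : B ψ' ψ' = (-l₀ * N * β ^ 2) * (1 - τ) := by
      rw [hψψ', hτ, mul_sub, mul_div_cancel₀ _ hβ0.ne']; ring
    rw [hcross, e] at hCS
    have : (-l₀ * N * β ^ 2) * (-l₀ * N * α ^ 2) ≤
        (-l₀ * N * β ^ 2) * (B h' h' * (1 - τ)) := by linarith
    exact le_of_mul_le_mul_left this hβ0
  have hτB : 0 ≤ τ * B h' h' := mul_nonneg hτ0.le h'1
  have hm1 : min (τ / 2 * l₂) (τ / 2 * -l₀) * G h' h' ≤ τ / 2 * B h' h' :=
    (mul_le_mul_of_nonneg_right (min_le_left _ _) (hG0 _)).trans (by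
      rw [mul_assoc]; exact mul_le_mul_of_nonneg_left h'0 (by positivity))
  have hm2 : min (τ / 2 * l₂) (τ / 2 * -l₀) * (N * α ^ 2) ≤ τ / 2 * B h' h' := by
    refine (mul_le_mul_of_nonneg_right (min_le_right _ _) (by positivity)).trans ?_
    rw [mul_assoc]
    refine mul_le_mul_of_nonneg_left ?_ (by positivity)
    linarith
  rw [hGh, hBh]
  linarith

/-- Coercivity of a symmetric form `B` with one negative direction `χ` and one null direction `d`,
up to a multiple of the square of `⟨ρ, ·⟩`, when `ρ = L ψ` with `⟨ρ, ψ⟩ < 0`. -/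
lemma exists_coercive_of_index_one {V : Type*} [AddCommGroup V] [Module ℝ V]
    (G B : V →ₗ[ℝ] V →ₗ[ℝ] ℝ) (hG : ∀ u v, G u v = G v u) (hB : ∀ u v, B u v = B v u)
    (hG0 : ∀ v, 0 ≤ G v v) {χ d ψ ρ : V} {l₀ l₂ : ℝ} (hl₀ : l₀ < 0) (hl₂ : 0 < l₂)
    (hχ : ∀ v, B χ v = l₀ * G χ v) (hχ0 : 0 < G χ χ) (hd : ∀ v, B d v = 0) (hd0 : 0 < G d d)
    (hψ : ∀ v, B ψ v = G ρ v) (hψ0 : G ρ ψ < 0)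
    (hpos : ∀ h, G χ h = 0 → G d h = 0 → l₂ * G h h ≤ B h h) :
    ∃ m > 0, ∃ N > 0, ∀ h, G d h = 0 → m * G h h ≤ B h h + N * G ρ h ^ 2 := by
  have hχd : G χ d = 0 := by
    have := hχ d
    rw [hB, hd] at this
    rcases mul_eq_zero.1 this.symm with h | h
    · exact absurd h hl₀.ne
    · exact h
  have hρd : G ρ d = 0 := by rw [← hψ, hB, hd]
  -- `ψ` may be assumed orthogonal to `d`.
  wlog hψd : G d ψ = 0 generalizing ψ
  · refine this (ψ := ψ - (G d ψ / G d d) • d) ?_ ?_ ?_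
    · intro v; simp [hψ, hd]
    · simpa [hρd] using hψ0
    · simp [hd0.ne']
  obtain ⟨m, hm0, main⟩ := exists_coercive_on_complement G B hG hB hG0 hl₀ hl₂ hχ hχ0 hχd hψd hψ
    hψ0 hpos
  obtain ⟨σ, hσ⟩ : ∃ σ, σ = -G ρ ψ := ⟨_, rfl⟩
  have hσ0 : 0 < σ := by linarith
  refine ⟨m / 2, by positivity, 1 / σ + m * G ψ ψ / σ ^ 2, by
    have := hG0 ψ
    positivity, fun h hdh => ?_⟩
  obtain ⟨ν, hν⟩ : ∃ ν, G ρ h = ν := ⟨_, rfl⟩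
  obtain ⟨t, ht⟩ : ∃ t, t = ν / σ := ⟨_, rfl⟩
  have hνt : ν = t * σ := by rw [ht]; field_simp
  have e0 : G ρ ψ = -σ := by rw [hσ]; ring
  -- `h + t ψ` is orthogonal to `ρ`, hence `B`-orthogonal to `ψ`.
  have h1 := main (h + t • ψ) (by simp [hdh, hψd]) (by
    simp only [map_add, map_smul, smul_eq_mul, e0, hν, hνt]
    ring)
  have e1 : B (h + t • ψ) (h + t • ψ) = B h h + ν ^ 2 / σ := by
    have e2 : B h ψ = ν := by rw [hB, hψ, hν]
    have e3 : B ψ h = ν := by rw [hψ, hν]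
    have e4 : B ψ ψ = -σ := by rw [hψ, e0]
    simp only [map_add, map_smul, LinearMap.add_apply, LinearMap.smul_apply, smul_eq_mul, e2, e3,
      e4, hνt]
    field_simp
    ring
  have h2 : G h h ≤ 2 * G (h + t • ψ) (h + t • ψ) + 2 * t ^ 2 * G ψ ψ := by
    have h3 := hG0 (h + (2 * t) • ψ)
    simp only [map_add, map_smul, LinearMap.add_apply, LinearMap.smul_apply, smul_eq_mul,
      hG ψ h] at h3 ⊢
    linarith
  rw [e1] at h1
  have h4 := mul_le_mul_of_nonneg_left h2 (by positivity : 0 ≤ m / 2)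
  have e2 : (1 / σ + m * G ψ ψ / σ ^ 2) * ν ^ 2 = ν ^ 2 / σ + m * t ^ 2 * G ψ ψ := by
    rw [hνt]; field_simp
  rw [hν, e2]
  linarith

/-! ### The profile equation -/

namespace IsProfile

variable {a c T : ℝ} {r : ℝ → ℝ}

lemma continuous (hr : IsProfile a c T r) : Continuous r := hr.contDiff.continuous

lemma hasDerivAt (hr : IsProfile a c T r) (x : ℝ) : HasDerivAt r (deriv r x) x :=
  (hr.contDiff.differentiable two_ne_zero x).hasDerivAt

lemma hasDerivAt_deriv (hr : IsProfile a c T r) (x : ℝ) :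
    HasDerivAt (deriv r) (-2 * r x ^ 3 - a * r x) x := by
  have h1 : ContDiff ℝ 1 (deriv r) := by
    have := hr.contDiff
    rw [show (2 : WithTop ℕ∞) = 1 + 1 by norm_num, contDiff_succ_iff_deriv] at this
    exact this.2.2
  have h2 := (h1.differentiable one_ne_zero x).hasDerivAt
  rwa [show deriv (deriv r) x = -2 * r x ^ 3 - a * r x by linarith [hr.ode x]] at h2

lemma continuous_deriv (hr : IsProfile a c T r) : Continuous (deriv r) :=
  continuous_iff_continuousAt.2 fun x => (hr.hasDerivAt_deriv x).continuousAt

lemma periodic (hr : IsProfile a c T r) : Function.Periodic r T := hr.least_period.1.2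

lemma pos (hr : IsProfile a c T r) : 0 < T := hr.least_period.1.1

lemma periodic_deriv (hr : IsProfile a c T r) : Function.Periodic (deriv r) T := fun x => by
  rw [← deriv_comp_add_const, show (fun x => r (x + T)) = r from funext hr.periodic]

lemma ne_zero (hr : IsProfile a c T r) (hc : c < 0) (x : ℝ) : r x ≠ 0 := fun h => by
  have := hr.energy x
  rw [h] at this
  nlinarith [sq_nonneg (deriv r x)]

lemma sq_lt (hr : IsProfile a c T r) (hc : c < 0) (x : ℝ) : r x ^ 2 < -a := by
  have h1 := hr.energy x
  have h2 : 0 < r x ^ 2 := by have := hr.ne_zero hc x; positivity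
  by_contra! h
  nlinarith [sq_nonneg (deriv r x), mul_nonneg h2.le (by linarith : 0 ≤ r x ^ 2 + a)]

/-- A solution is symmetric about each of its critical points, by uniqueness for the Cauchy
problem. -/
lemma reflect (hr : IsProfile a c T r) (ha : a < 0) (hc : c < 0) {p : ℝ} (hp : deriv r p = 0)
    (x : ℝ) : r (2 * p - x) = r x := by
  set v : ℝ → ℝ × ℝ → ℝ × ℝ := fun _ y => (y.2, -2 * y.1 ^ 3 - a * y.1) with hv
  set s : Set (ℝ × ℝ) := {y | y.1 ^ 2 ≤ -a} with hs
  have hK : (0 : ℝ) ≤ 1 + 7 * -a := by linarith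
  have hlip : ∀ t : ℝ, LipschitzOnWith (1 + 7 * -a).toNNReal (v t) s := by
    intro t
    refine LipschitzOnWith.of_dist_le_mul fun y hy z hz => ?_
    simp only [hs, mem_ofPred_eq] at hy hz
    rw [Real.coe_toNNReal _ hK, Prod.dist_eq, Prod.dist_eq]
    have h1 := le_max_left (dist y.1 z.1) (dist y.2 z.2)
    have h2 := le_max_right (dist y.1 z.1) (dist y.2 z.2)
    set m := max (dist y.1 z.1) (dist y.2 z.2)
    have hm : 0 ≤ m := dist_nonneg.trans h1
    refine max_le ?_ ?_
    · simp only [hv]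
      nlinarith
    · simp only [hv, Real.dist_eq] at h1 ⊢
      have e : -2 * y.1 ^ 3 - a * y.1 - (-2 * z.1 ^ 3 - a * z.1) =
          (-2 * (y.1 ^ 2 + y.1 * z.1 + z.1 ^ 2) - a) * (y.1 - z.1) := by ring
      rw [e, abs_mul]
      refine mul_le_mul ?_ h1 (abs_nonneg _) hK
      rw [abs_le]
      constructor <;> nlinarith [sq_nonneg (y.1 + z.1), sq_nonneg (y.1 - z.1)]
  have h1 : ∀ t, HasDerivAt (fun x => (r x, deriv r x)) (v t (r t, deriv r t)) t ∧
      (r t, deriv r t) ∈ s := fun t =>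
    ⟨(hr.hasDerivAt t).prodMk (hr.hasDerivAt_deriv t), (hr.sq_lt hc t).le⟩
  have h2 : ∀ t, HasDerivAt (fun x => (r (2 * p - x), -deriv r (2 * p - x)))
      (v t (r (2 * p - t), -deriv r (2 * p - t))) t ∧
      (r (2 * p - t), -deriv r (2 * p - t)) ∈ s := fun t => by
    refine ⟨?_, (hr.sq_lt hc _).le⟩
    have hl : HasDerivAt (fun x : ℝ => 2 * p - x) (-1) t := by
      simpa using (hasDerivAt_id t).const_sub (2 * p)
    have := ((hr.hasDerivAt (2 * p - t)).comp t hl).prodMk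
      ((hr.hasDerivAt_deriv (2 * p - t)).comp t hl).neg
    simpa [hv, Function.comp_def, sub_eq_add_neg] using this
  have := ODE_solution_unique_univ (t₀ := p) hlip h2 h1 (by
    simp [show 2 * p - p = p by ring, hp])
  exact congrArg Prod.fst (congrFun this x)

lemma reflect_deriv (hr : IsProfile a c T r) (ha : a < 0) (hc : c < 0) {p : ℝ} (hp : deriv r p = 0)
    (x : ℝ) : deriv r (2 * p - x) = -deriv r x := by
  have h := congrArg (fun f => deriv f x) (funext (hr.reflect ha hc hp))
  simp only [deriv_comp_const_sub] at h
  linarith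

/-- Since `T` is the least period, the critical points of `r` are spaced by exactly `T/2`. -/
lemma exists_half_period (hr : IsProfile a c T r) (ha : a < 0) (hc : c < 0) :
    ∃ p, deriv r p = 0 ∧ deriv r (p + T / 2) = 0 ∧ ∀ x ∈ Ioo p (p + T / 2), deriv r x ≠ 0 := by
  obtain ⟨p, -, hp⟩ := exists_deriv_eq_zero hr.pos hr.continuous.continuousOn
    (by simpa using (hr.periodic 0).symm)
  refine ⟨p, hp, ?_, fun x hx h => ?_⟩
  · have h1 := hr.reflect_deriv ha hc hp (p - T / 2)
    have h2 := hr.periodic_deriv (p - T / 2)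
    rw [show p - T / 2 + T = p + T / 2 by ring] at h2
    rw [show 2 * p - (p - T / 2) = p + T / 2 by ring] at h1
    linarith
  · -- two reflections compose to a translation by `2 (x - p) < T`
    have hper : Function.Periodic r (2 * (x - p)) := fun y => by
      rw [← hr.reflect ha hc h, ← hr.reflect ha hc hp y]
      congr 1
      ring
    have := hr.least_period.2 ⟨by linarith [hx.1], hper⟩
    linarith [hx.2]

/-- A value strictly between the extrema of `r²` is taken exactly twice per period, at two points
which are symmetric about a critical point. -/
lemma exists_level_points (hr : IsProfile a c T r) (ha : a < 0) (hc : c < 0) {ρ : ℝ}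
    (hρ : ρ ^ 2 + a * ρ - c < 0) :
    ∃ x₀ x₁, x₀ < x₁ ∧ x₁ < x₀ + T ∧ r x₀ ^ 2 = ρ ∧ r x₁ ^ 2 = ρ ∧ deriv r x₁ ≠ 0 ∧
      deriv r x₀ = -deriv r x₁ ∧ (∀ x ∈ Ioo x₀ x₁, r x ^ 2 ≠ ρ) ∧
      ∀ x ∈ Ioo x₁ (x₀ + T), r x ^ 2 ≠ ρ := by
  obtain ⟨p, hp, hp', hne⟩ := hr.exists_half_period ha hc
  have hT := hr.pos
  have hd : ∀ x, HasDerivAt (fun x => r x ^ 2) (2 * r x * deriv r x) x := fun x => by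
    simpa using (hr.hasDerivAt x).fun_pow 2
  have hcont : Continuous fun x => r x ^ 2 := hr.continuous.pow 2
  have hinj : ∀ x ∈ Icc p (p + T / 2), ∀ y ∈ Icc p (p + T / 2), x < y → r x ^ 2 ≠ r y ^ 2 := by
    intro x hx y hy hxy h
    obtain ⟨z, hz, h0⟩ := exists_hasDerivAt_eq_zero hxy hcont.continuousOn h fun x _ => hd x
    have := hr.ne_zero hc z
    have := hne z ⟨hx.1.trans_lt hz.1, hz.2.trans_le hy.2⟩
    simp_all
  have hpq := hinj p ⟨le_rfl, by linarith⟩ (p + T / 2) ⟨by linarith, le_rfl⟩ (by linarith)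
  have e1 := hr.energy p
  have e2 := hr.energy (p + T / 2)
  rw [hp] at e1
  rw [hp'] at e2
  have hsum : r p ^ 2 + r (p + T / 2) ^ 2 = -a := by
    have : (r p ^ 2 - r (p + T / 2) ^ 2) * (r p ^ 2 + r (p + T / 2) ^ 2 + a) = 0 := by
      linear_combination e1 - e2
    rcases mul_eq_zero.1 this with h | h
    · exact absurd (sub_eq_zero.1 h) hpq
    · linarith
  have hmul : (r p ^ 2 - ρ) * (r (p + T / 2) ^ 2 - ρ) < 0 := by
    have : r (p + T / 2) ^ 2 = -a - r p ^ 2 := by linarith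
    rw [this]
    nlinarith
  obtain ⟨y, hy, hyρ⟩ : ∃ y ∈ Ioo p (p + T / 2), r y ^ 2 = ρ := by
    rcases mul_neg_iff.1 hmul with h | h
    · exact intermediate_value_Ioo' (by linarith) hcont.continuousOn
        (show ρ ∈ Ioo _ _ from ⟨by linarith [h.2], by linarith [h.1]⟩)
    · exact intermediate_value_Ioo (by linarith) hcont.continuousOn
        (show ρ ∈ Ioo _ _ from ⟨by linarith [h.1], by linarith [h.2]⟩)
  have huniq : ∀ x ∈ Icc p (p + T / 2), x ≠ y → r x ^ 2 ≠ ρ := by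
    intro x hx hxy
    rw [← hyρ]
    rcases lt_or_gt_of_ne hxy with h | h
    · exact hinj x hx y ⟨hy.1.le, hy.2.le⟩ h
    · exact (hinj y ⟨hy.1.le, hy.2.le⟩ x hx h).symm
  refine ⟨2 * p - y, y, by linarith [hy.1], by linarith [hy.2], ?_, hyρ, hne y hy,
    hr.reflect_deriv ha hc hp y, ?_, ?_⟩
  · rw [hr.reflect ha hc hp, hyρ]
  · intro x hx
    rcases le_total p x with h | h
    · exact huniq x ⟨h, by linarith [hx.2, hy.2]⟩ hx.2.ne
    · rw [← hr.reflect ha hc hp x]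
      exact huniq _ ⟨by linarith, by linarith [hx.1, hy.2]⟩ (by linarith [hx.1])
  · intro x hx
    rcases le_total x (p + T / 2) with h | h
    · exact huniq x ⟨by linarith [hx.1, hy.1], h⟩ hx.1.ne'
    · rw [← hr.reflect ha hc hp' x]
      exact huniq _ ⟨by linarith [hx.2, hy.1], by linarith⟩ (by linarith [hx.2])

end IsProfile

/-! ### Jacobi's argument -/

/-- Jacobi's argument on one nodal interval of `v`, where `v'' = -q v`: writing `k = v w` one has
`k'² - q k² = (v w')² + (v'k²/v)'`. Since `k` vanishes at the simple zeros `α`, `β` of `v`, the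
function `v'k²/v` extends continuously by zero to them; this is also the value that division by
zero assigns to it there. -/
lemma integral_nonneg_of_nodal {α β : ℝ} (hαβ : α < β) {v v' q k : ℝ → ℝ}
    (hv : ∀ x, HasDerivAt v (v' x) x) (hv' : ∀ x, HasDerivAt v' (-q x * v x) x)
    (hq : Continuous q) (hvα : v α = 0) (hvβ : v β = 0) (hv'α : v' α ≠ 0) (hv'β : v' β ≠ 0)
    (hne : ∀ x ∈ Ioo α β, v x ≠ 0) (hk : ContDiff ℝ 1 k) (hkα : k α = 0) (hkβ : k β = 0) :
    0 ≤ ∫ x in α..β, (deriv k x ^ 2 - q x * k x ^ 2) := by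
  have hkd : ∀ x, HasDerivAt k (deriv k x) x := fun x =>
    (hk.differentiable one_ne_zero x).hasDerivAt
  have hkc : Continuous k := hk.continuous
  have hkc' : Continuous (deriv k) := hk.continuous_deriv le_rfl
  have hvc : Continuous v := continuous_iff_continuousAt.2 fun x => (hv x).continuousAt
  have hvc' : Continuous v' := continuous_iff_continuousAt.2 fun x => (hv' x).continuousAt
  set g : ℝ → ℝ := fun x => v' x * k x ^ 2 / v x with hg
  -- continuity at a simple zero of `v`, from the limits of the difference quotients
  have hend : ∀ z, v z = 0 → v' z ≠ 0 → k z = 0 → ContinuousAt g z := by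
    intro z h1 h2 h3
    have hs1 := hasDerivAt_iff_tendsto_slope.1 (hv z)
    have hs2 := hasDerivAt_iff_tendsto_slope.1 (hkd z)
    have hk0 : Filter.Tendsto k (nhdsWithin z {z}ᶜ) (nhds (k z)) :=
      hkc.continuousAt.tendsto.mono_left nhdsWithin_le_nhds
    have hv0 : Filter.Tendsto v' (nhdsWithin z {z}ᶜ) (nhds (v' z)) :=
      hvc'.continuousAt.tendsto.mono_left nhdsWithin_le_nhds
    have hlim := (hv0.mul hk0).mul (hs2.div hs1 h2)
    rw [continuousAt_iff_punctured_nhds]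
    have e : g z = v' z * k z * (deriv k z / v' z) := by simp [hg, h3]
    rw [e]
    refine hlim.congr' ?_
    filter_upwards [self_mem_nhdsWithin] with x hx
    have hx' : x - z ≠ 0 := sub_ne_zero.2 hx
    simp only [slope_def_field, h1, h3, sub_zero, hg, Pi.div_apply]
    by_cases hvx : v x = 0
    · simp [hvx]
    · field_simp
  have hgc : ContinuousOn g (Icc α β) := by
    intro x hx
    rcases eq_or_lt_of_le hx.1 with rfl | h1
    · exact (hend _ hvα hv'α hkα).continuousWithinAt
    rcases eq_or_lt_of_le hx.2 with rfl | h2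
    · exact (hend _ hvβ hv'β hkβ).continuousWithinAt
    exact (ContinuousAt.div (by fun_prop) (by fun_prop) (hne x ⟨h1, h2⟩)).continuousWithinAt
  have key := intervalIntegral.sub_le_integral_of_hasDeriv_right_of_le
    (g' := fun x => deriv k x ^ 2 - q x * k x ^ 2 - (deriv k x - v' x * k x / v x) ^ 2)
    (φ := fun x => deriv k x ^ 2 - q x * k x ^ 2) hαβ.le hgc
    (fun x hx => by
      have h0 := hne x hx
      have h := (((hv' x).mul ((hkd x).pow 2)).div (hv x) h0)
      refine (h.congr_deriv ?_).hasDerivWithinAt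
      simp only [Pi.mul_apply, Pi.pow_apply]
      field_simp
      ring)
    (Continuous.integrableOn_Icc (by fun_prop))
    (fun x _ => by nlinarith [sq_nonneg (deriv k x - v' x * k x / v x)])
  simpa [hg, hkα, hkβ] using key

/-! ### The spectrum of the linearized operator in the real direction -/

/-- The potential `a + κ r²`: for `κ = 6` and `κ = 2`, the operators `-∂² - a - κ r²` are the
second variations at `r` of `∫ (|g'|² - |g|⁴ - a |g|²)` in the real and imaginary directions. -/
noncomputable def potential (a κ : ℝ) {r : ℝ → ℝ} (hr : Continuous r) : C(ℝ, ℝ) :=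
  ⟨fun x => a + κ * r x ^ 2, by fun_prop⟩

lemma potential_apply (a κ : ℝ) {r : ℝ → ℝ} (hr : Continuous r) (x : ℝ) :
    potential a κ hr x = a + κ * r x ^ 2 := rfl

lemma contDiff_one_of_hasDerivAt {f f' : ℝ → ℝ} (h : ∀ x, HasDerivAt f (f' x) x)
    (hc : Continuous f') : ContDiff ℝ 1 f := by
  rw [contDiff_one_iff_deriv, show deriv f = f' from funext fun x => (h x).deriv]
  exact ⟨fun x => (h x).differentiableAt, hc⟩

lemma l2Form_self_nonneg {T : ℝ} (hT : 0 ≤ T) (h : PerC1 T) : 0 ≤ l2Form T h h :=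
  intervalIntegral.integral_nonneg hT fun _ _ => mul_self_nonneg _

lemma l2Form_self_pos {T : ℝ} (hT : 0 < T) (h : PerC1 T) {x : ℝ} (hx : h.1 x ≠ 0) :
    0 < l2Form T h h := by
  have := PerC1.continuous h
  obtain ⟨y, hy, hxy⟩ := (PerC1.periodic h).exists_mem_Ico₀ hT x
  exact intervalIntegral.integral_pos hT (by fun_prop) (fun _ _ => mul_self_nonneg _)
    ⟨y, ⟨hy.1, hy.2.le⟩, mul_self_pos.2 (hxy ▸ hx)⟩

namespace IsProfile

variable {a c T : ℝ} {r : ℝ → ℝ}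

/-- The profile `r` as an element of `PerC1 T`. -/
def toPerC1 (hr : IsProfile a c T r) : PerC1 T :=
  ⟨r, hr.contDiff.of_le one_le_two, hr.periodic⟩

/-- The derivative `r'` as an element of `PerC1 T`. -/
noncomputable def derivPerC1 (hr : IsProfile a c T r) : PerC1 T :=
  ⟨deriv r, contDiff_one_of_hasDerivAt hr.hasDerivAt_deriv (by have := hr.continuous; fun_prop),
    hr.periodic_deriv⟩

/-- The function `r² + κ` as an element of `PerC1 T`. -/
noncomputable def sqAdd (hr : IsProfile a c T r) (κ : ℝ) : PerC1 T :=
  ⟨fun x => r x ^ 2 + κ, ((hr.contDiff.of_le one_le_two).pow 2).add contDiff_const,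
    fun x => by simp only [hr.periodic x]⟩

lemma hasDerivAt_sqAdd (hr : IsProfile a c T r) (κ x : ℝ) :
    HasDerivAt (fun x => r x ^ 2 + κ) (2 * r x * deriv r x) x := by
  simpa using ((hr.hasDerivAt x).fun_pow 2).add_const κ

lemma hasDerivAt_mul_deriv (hr : IsProfile a c T r) (x : ℝ) :
    HasDerivAt (fun x => 2 * r x * deriv r x) (2 * c - 6 * r x ^ 4 - 4 * a * r x ^ 2) x := by
  have := ((hr.hasDerivAt x).const_mul 2).mul (hr.hasDerivAt_deriv x)
  refine this.congr_deriv ?_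
  linear_combination 2 * hr.energy x

/-- `r² + κ` is an eigenfunction of `-∂² - a - 6 r²` with eigenvalue `3 a - 6 κ` if
`3 κ² - 2 a κ - c = 0`. -/
lemma schrForm_sqAdd (hr : IsProfile a c T r) {κ : ℝ} (hκ : 3 * κ ^ 2 - 2 * a * κ - c = 0)
    (v : PerC1 T) :
    schrForm T (potential a 6 hr.continuous) (hr.sqAdd κ) v =
      (3 * a - 6 * κ) * l2Form T (hr.sqAdd κ) v := by
  have := hr.continuous
  rw [schrForm_eq_integral _ _ (hr.hasDerivAt_sqAdd κ) hr.hasDerivAt_mul_deriv (by fun_prop)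
    (f := fun x => (3 * a - 6 * κ) * (r x ^ 2 + κ)), l2Form_apply,
    ← intervalIntegral.integral_const_mul]
  · exact intervalIntegral.integral_congr fun x _ => by simp only [sqAdd]; ring
  · intro x
    simp only [potential_apply, sqAdd]
    linear_combination 2 * hκ

/-- `r'` is in the kernel of `-∂² - a - 6 r²`. -/
lemma schrForm_deriv (hr : IsProfile a c T r) (v : PerC1 T) :
    schrForm T (potential a 6 hr.continuous) hr.derivPerC1 v = 0 := by
  have := hr.continuous; have := hr.continuous_deriv
  rw [schrForm_eq_integral _ _ hr.hasDerivAt_deriv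
    (h₂ := fun x => -(6 * r x ^ 2 + a) * deriv r x) (f := fun _ => 0)]
  · simp
  · intro x
    refine ((((hr.hasDerivAt x).fun_pow 3).const_mul (-2)).sub
      ((hr.hasDerivAt x).const_mul a)).congr_deriv ?_
    norm_num
    ring
  · fun_prop
  · intro x
    simp only [potential_apply, derivPerC1]
    ring

/-- The mean value of `r²`. -/
noncomputable def mean (_ : IsProfile a c T r) : ℝ := (∫ x in (0 : ℝ)..T, r x ^ 2) / T

lemma integral_sq (hr : IsProfile a c T r) : ∫ x in (0 : ℝ)..T, r x ^ 2 = hr.mean * T := by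
  rw [mean, div_mul_cancel₀ _ hr.pos.ne']

/-- The mean of `r²` exceeds the geometric mean `√(-c)` of its extreme values: since
`(r'/r)' = -r² - c/r²`, the functions `r²` and `-c/r²` have the same mean. -/
lemma sqrt_lt_mean (hr : IsProfile a c T r) (hc₀ : -(a ^ 2 / 4) < c) (hc : c < 0) :
    √(-c) < hr.mean := by
  have hT := hr.pos
  have h0 := hr.ne_zero hc
  have hrc := hr.continuous
  have hs : √(-c) ^ 2 = -c := Real.sq_sqrt (by linarith)
  have e1 : ∫ x in (0 : ℝ)..T, (-r x ^ 2 - c / r x ^ 2) = 0 :=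
    integral_deriv_eq_zero_of_periodic (f := fun x => deriv r x / r x)
      (fun x => by
        refine ((hr.hasDerivAt_deriv x).div (hr.hasDerivAt x) (h0 x)).congr_deriv ?_
        have := h0 x
        field_simp
        linear_combination -hr.energy x)
      ((hrc.pow 2).neg.sub (continuous_const.div (hrc.pow 2) fun x => pow_ne_zero 2 (h0 x)))
      (hr.periodic_deriv.div hr.periodic)
  have hcd : Continuous fun x => ((r x ^ 2 - √(-c)) / r x) ^ 2 :=
    ((by fun_prop : Continuous fun x => r x ^ 2 - √(-c)).div hrc h0).pow 2
  have hne : ∃ y ∈ Icc 0 T, 0 < ((r y ^ 2 - √(-c)) / r y) ^ 2 := by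
    obtain ⟨p, hp0, hp⟩ := exists_deriv_eq_zero hT hrc.continuousOn
      (by simpa using (hr.periodic 0).symm)
    refine ⟨p, ⟨hp0.1.le, hp0.2.le⟩, ?_⟩
    have : r p ^ 2 - √(-c) ≠ 0 := by
      -- equality would make `r²` constant, at the minimum `c = -a²/4` of the energy
      intro h
      have h1 := hr.energy p
      rw [hp] at h1
      have h2 : r p ^ 2 = √(-c) := by linarith
      have h3 : a * √(-c) = 2 * c := by
        rw [← h2]
        linear_combination h1 - hs - (r p ^ 2 + √(-c)) * h
      nlinarith
    have := h0 p
    positivity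
  have e2 : 0 < ∫ x in (0 : ℝ)..T, ((r x ^ 2 - √(-c)) / r x) ^ 2 :=
    intervalIntegral.integral_pos hT hcd.continuousOn (fun x _ => sq_nonneg _) hne
  have e3 : ∫ x in (0 : ℝ)..T, ((r x ^ 2 - √(-c)) / r x) ^ 2 =
      ∫ x in (0 : ℝ)..T, ((-r x ^ 2 - c / r x ^ 2) + (2 * r x ^ 2 - 2 * √(-c))) :=
    intervalIntegral.integral_congr fun x _ => by
      have := h0 x
      field_simp
      linear_combination hs
  rw [e3, intervalIntegral.integral_add, e1, intervalIntegral.integral_sub,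
    intervalIntegral.integral_const_mul, hr.integral_sq, intervalIntegral.integral_const] at e2
  · simp only [smul_eq_mul] at e2
    nlinarith
  · exact Continuous.intervalIntegrable (by fun_prop) _ _
  · exact Continuous.intervalIntegrable (by fun_prop) _ _
  · exact ((hrc.pow 2).neg.sub (continuous_const.div (hrc.pow 2)
      fun x => pow_ne_zero 2 (h0 x))).intervalIntegrable _ _
  · exact Continuous.intervalIntegrable (by fun_prop) _ _

/-- The primitive `∫₀ˣ r² - μ x`, where `μ` is the mean of `r²`. -/
noncomputable def primitive (hr : IsProfile a c T r) (x : ℝ) : ℝ :=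
  (∫ y in (0 : ℝ)..x, r y ^ 2) - hr.mean * x

lemma hasDerivAt_primitive (hr : IsProfile a c T r) (x : ℝ) :
    HasDerivAt hr.primitive (r x ^ 2 - hr.mean) x := by
  have h := hr.continuous
  have h1 := (h.pow 2).integral_hasStrictDerivAt 0 x
  exact (h1.hasDerivAt.sub ((hasDerivAt_id x).const_mul hr.mean)).congr_deriv (by simp)

lemma periodic_primitive (hr : IsProfile a c T r) : Function.Periodic hr.primitive T := by
  intro x
  have hrc := hr.continuous
  have h1 : Function.Periodic (fun x => r x ^ 2) T := fun x => by simp only [hr.periodic x]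
  have h2 := intervalIntegral.integral_add_adjacent_intervals
    ((hrc.pow 2).intervalIntegrable (μ := MeasureTheory.volume) 0 x)
    ((hrc.pow 2).intervalIntegrable (μ := MeasureTheory.volume) x (x + T))
  have h3 := h1.intervalIntegral_add_eq x 0
  rw [zero_add, hr.integral_sq] at h3
  simp only [Pi.pow_apply] at h2
  rw [primitive, primitive, ← h2, h3]
  ring

/-- The solution `ψ = (r' Y - r³ - (a + μ) r) / (4 c - 2 a μ)` of `(-∂² - a - 6 r²) ψ = r`, where
`μ` is the mean of `r²` and `Y` the periodic primitive of `r² - μ`. It is the combination of the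
two nonperiodic solutions that come from the scaling `r + x r'` and from the second solution of the
homogeneous equation in which the secular terms `x r'` cancel. -/
noncomputable def invProfileFun (hr : IsProfile a c T r) (x : ℝ) : ℝ :=
  (deriv r x * hr.primitive x - r x ^ 3 - (a + hr.mean) * r x) / (4 * c - 2 * a * hr.mean)

lemma hasDerivAt_invProfileFun (hr : IsProfile a c T r) (x : ℝ) :
    HasDerivAt hr.invProfileFun
      (((-2 * r x ^ 3 - a * r x) * hr.primitive x - (2 * r x ^ 2 + 2 * hr.mean + a) * deriv r x) /
        (4 * c - 2 * a * hr.mean)) x := by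
  have h := ((((hr.hasDerivAt_deriv x).mul (hr.hasDerivAt_primitive x)).sub
    ((hr.hasDerivAt x).fun_pow 3)).sub ((hr.hasDerivAt x).const_mul (a + hr.mean))).div_const
      (4 * c - 2 * a * hr.mean)
  refine h.congr_deriv ?_
  norm_num
  ring

/-- `ψ` as an element of `PerC1 T`. -/
noncomputable def invProfile (hr : IsProfile a c T r) : PerC1 T :=
  ⟨hr.invProfileFun, contDiff_one_of_hasDerivAt hr.hasDerivAt_invProfileFun (by
      have := hr.continuous; have := hr.continuous_deriv
      have : Continuous hr.primitive :=
        continuous_iff_continuousAt.2 fun x => (hr.hasDerivAt_primitive x).continuousAt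
      fun_prop),
    fun x => by
      rw [invProfileFun, invProfileFun, hr.periodic, hr.periodic_deriv, hr.periodic_primitive]⟩

lemma denom_pos (hr : IsProfile a c T r) (ha : a < 0) (hc₀ : -(a ^ 2 / 4) < c) (hc : c < 0) :
    0 < 4 * c - 2 * a * hr.mean := by
  have h1 := hr.sqrt_lt_mean hc₀ hc
  have hs : √(-c) ^ 2 = -c := Real.sq_sqrt (by linarith)
  have hs0 : 0 < √(-c) := Real.sqrt_pos.2 (by linarith)
  have h2 : 2 * √(-c) < -a := by
    by_contra! h
    nlinarith
  nlinarith

lemma schrForm_invProfile (hr : IsProfile a c T r) (ha : a < 0) (hc₀ : -(a ^ 2 / 4) < c)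
    (hc : c < 0) (v : PerC1 T) :
    schrForm T (potential a 6 hr.continuous) hr.invProfile v = l2Form T hr.toPerC1 v := by
  have hD := hr.denom_pos ha hc₀ hc
  have := hr.continuous; have := hr.continuous_deriv
  have hYc : Continuous hr.primitive :=
    continuous_iff_continuousAt.2 fun x => (hr.hasDerivAt_primitive x).continuousAt
  rw [schrForm_eq_integral _ _ hr.hasDerivAt_invProfileFun
    (h₂ := fun x => (-(6 * r x ^ 2 + a) * deriv r x * hr.primitive x +
      (-2 * r x ^ 3 - a * r x) * (r x ^ 2 - hr.mean) - 4 * r x * deriv r x ^ 2 -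
      (2 * r x ^ 2 + 2 * hr.mean + a) * (-2 * r x ^ 3 - a * r x)) / (4 * c - 2 * a * hr.mean))
    (f := r)]
  · rfl
  · intro x
    have h1 := ((((hr.hasDerivAt x).fun_pow 3).const_mul (-2)).sub
      ((hr.hasDerivAt x).const_mul a)).mul (hr.hasDerivAt_primitive x)
    have h2 := (((((hr.hasDerivAt x).fun_pow 2).const_mul 2).add_const (2 * hr.mean)).add_const
      a).mul (hr.hasDerivAt_deriv x)
    refine ((h1.sub h2).div_const (4 * c - 2 * a * hr.mean)).congr_deriv ?_
    norm_num
    ring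
  · fun_prop
  · intro x
    simp only [potential_apply, invProfile, invProfileFun]
    obtain ⟨q, hq⟩ : ∃ q, 4 * c - 2 * a * hr.mean = q := ⟨_, rfl⟩
    rw [hq] at hD ⊢
    field_simp
    linear_combination 4 * r x * hr.energy x + r x * hq

/-- `⟨r, ψ⟩ < 0`. -/
lemma l2Form_invProfile_neg (hr : IsProfile a c T r) (ha : a < 0) (hc₀ : -(a ^ 2 / 4) < c)
    (hc : c < 0) : l2Form T hr.toPerC1 hr.invProfile < 0 := by
  have hT := hr.pos
  have hD := hr.denom_pos ha hc₀ hc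
  have := hr.continuous; have := hr.continuous_deriv
  have hYc : Continuous hr.primitive :=
    continuous_iff_continuousAt.2 fun x => (hr.hasDerivAt_primitive x).continuousAt
  have hψc := PerC1.continuous hr.invProfile
  have h1 := integral_deriv_eq_zero_of_periodic (T := T)
    (f := fun x => (r x ^ 2 + 0) * hr.primitive x + 2 * r x * deriv r x / 2)
    (f' := fun x => 2 * (4 * c - 2 * a * hr.mean) * (r x * hr.invProfile.1 x) +
      (c + hr.mean * r x ^ 2))
    (fun x => by
      refine (((hr.hasDerivAt_sqAdd 0 x).mul (hr.hasDerivAt_primitive x)).add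
        ((hr.hasDerivAt_mul_deriv x).div_const 2)).congr_deriv ?_
      simp only [invProfile, invProfileFun]
      obtain ⟨q, hq⟩ : ∃ q, 4 * c - 2 * a * hr.mean = q := ⟨_, rfl⟩
      rw [hq] at hD ⊢
      field_simp
      ring)
    (by fun_prop)
    (fun x => by simp only [hr.periodic x, hr.periodic_deriv x, hr.periodic_primitive x])
  rw [intervalIntegral.integral_add, intervalIntegral.integral_add,
    intervalIntegral.integral_const_mul, intervalIntegral.integral_const_mul, hr.integral_sq,
    intervalIntegral.integral_const] at h1
  · rw [l2Form_apply]
    change ∫ x in (0 : ℝ)..T, r x * hr.invProfile.1 x < 0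
    have h2 := hr.sqrt_lt_mean hc₀ hc
    have hs : √(-c) ^ 2 = -c := Real.sq_sqrt (by linarith)
    have h3 : 0 < c + hr.mean ^ 2 := by nlinarith [Real.sqrt_nonneg (-c)]
    have h4 : 0 < T * (c + hr.mean ^ 2) := by positivity
    simp only [smul_eq_mul] at h1
    by_contra! h
    have h5 := mul_nonneg hD.le h
    nlinarith
  all_goals exact Continuous.intervalIntegrable (by fun_prop) _ _

/-- Positivity of `-∂² - a - 6 r²` on the complement of its first two eigenfunctions `r² + κ₀` and
`r'`. Correcting `h` by these eigenfunctions produces a function that vanishes at the two zeros of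
the third eigenfunction `r² + κ₂`, to which Jacobi's argument applies. -/
lemma schrForm_ge_of_orthogonal (hr : IsProfile a c T r) (ha : a < 0) {κ₀ κ₂ : ℝ}
    (h₀ : 3 * κ₀ ^ 2 - 2 * a * κ₀ - c = 0) (h₂ : 3 * κ₂ ^ 2 - 2 * a * κ₂ - c = 0)
    (hlt : κ₂ < κ₀) (hκ₂ : κ₂ < 0) (hl₀ : 3 * a - 6 * κ₀ < 0) (hl₂ : 0 < 3 * a - 6 * κ₂)
    (hc : c < 0) (h : PerC1 T) (hχ : l2Form T (hr.sqAdd κ₀) h = 0)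
    (hd : l2Form T hr.derivPerC1 h = 0) :
    (3 * a - 6 * κ₂) * l2Form T h h ≤ schrForm T (potential a 6 hr.continuous) h h := by
  have hT := hr.pos
  have hrc := hr.continuous
  obtain ⟨x₀, x₁, h01, h1T, hx₀, hx₁, hd₁, hd₀, hne0, hne1⟩ :=
    hr.exists_level_points ha hc (ρ := -κ₂) (by nlinarith)
  set χ := hr.sqAdd κ₀ with hχdef
  set d := hr.derivPerC1 with hddef
  set B := schrForm T (potential a 6 hr.continuous) with hB
  have hκ : κ₀ - κ₂ ≠ 0 := by linarith
  obtain ⟨β, hβ⟩ : ∃ β, β = (h.1 x₀ + h.1 x₁) / (2 * (κ₀ - κ₂)) := ⟨_, rfl⟩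
  obtain ⟨γ, hγ⟩ : ∃ γ, γ = (h.1 x₁ - h.1 x₀) / (2 * deriv r x₁) := ⟨_, rfl⟩
  set k : PerC1 T := h - β • χ - γ • d with hk
  have hk0 : k.1 x₀ = 0 := by
    change h.1 x₀ - β * (r x₀ ^ 2 + κ₀) - γ * deriv r x₀ = 0
    rw [hx₀, hd₀, hβ, hγ, show -κ₂ + κ₀ = κ₀ - κ₂ by ring]
    field_simp
    ring
  have hk1 : k.1 x₁ = 0 := by
    change h.1 x₁ - β * (r x₁ ^ 2 + κ₀) - γ * deriv r x₁ = 0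
    rw [hx₁, hβ, hγ, show -κ₂ + κ₀ = κ₀ - κ₂ by ring]
    field_simp
    ring
  have hkB : (3 * a - 6 * κ₂) * l2Form T k k ≤ B k k := by
    have hkc := PerC1.continuous k
    have hkc' := PerC1.continuous_deriv k
    set f : ℝ → ℝ := fun x => deriv k.1 x ^ 2 - (a + 6 * r x ^ 2 + (3 * a - 6 * κ₂)) * k.1 x ^ 2
      with hf
    have hfc : Continuous f := by fun_prop
    have hfp : Function.Periodic f T := fun x => by
      have hp := PerC1.periodic k
      have hp' := PerC1.periodic_deriv k x
      simp only [hf, hp', hr.periodic x, hp x]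
    have e : B k k - (3 * a - 6 * κ₂) * l2Form T k k = ∫ x in (0 : ℝ)..T, f x := by
      rw [hB, schrForm_apply, l2Form_apply, ← intervalIntegral.integral_const_mul,
        ← intervalIntegral.integral_sub]
      · exact intervalIntegral.integral_congr fun x _ => by
          simp only [hf, potential_apply]; ring
      · exact Continuous.intervalIntegrable (by fun_prop) _ _
      · exact Continuous.intervalIntegrable (by fun_prop) _ _
    have hsplit := intervalIntegral.integral_add_adjacent_intervals
      (hfc.intervalIntegrable (μ := MeasureTheory.volume) x₀ x₁)
      (hfc.intervalIntegrable (μ := MeasureTheory.volume) x₁ (x₀ + T))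
    have hshift := hfp.intervalIntegral_add_eq x₀ 0
    rw [zero_add] at hshift
    have hv' : ∀ x, HasDerivAt (fun x => 2 * r x * deriv r x)
        (-(a + 6 * r x ^ 2 + (3 * a - 6 * κ₂)) * (r x ^ 2 + κ₂)) x := fun x =>
      (hr.hasDerivAt_mul_deriv x).congr_deriv (by linear_combination (-2) * h₂)
    have hz0 : 2 * r x₀ * deriv r x₀ ≠ 0 := by
      have := hr.ne_zero hc x₀
      rw [hd₀]
      simp [this, hd₁]
    have hz1 : 2 * r x₁ * deriv r x₁ ≠ 0 := by
      have := hr.ne_zero hc x₁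
      simp [this, hd₁]
    have i1 : 0 ≤ ∫ x in x₀..x₁, f x :=
      integral_nonneg_of_nodal h01 (hr.hasDerivAt_sqAdd κ₂) hv' (by fun_prop)
        (by linarith) (by linarith) hz0 hz1 (fun x hx h => hne0 x hx (by linarith))
        (PerC1.contDiff k) hk0 hk1
    have i2 : 0 ≤ ∫ x in x₁..x₀ + T, f x :=
      integral_nonneg_of_nodal h1T (hr.hasDerivAt_sqAdd κ₂) hv' (by fun_prop)
        (by linarith) (by rw [hr.periodic]; linarith) hz1
        (by rwa [hr.periodic, hr.periodic_deriv]) (fun x hx h => hne1 x hx (by linarith))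
        (PerC1.contDiff k) hk1 (by rw [PerC1.periodic k, hk0])
    linarith
  have hBd : ∀ v, B d v = 0 := hr.schrForm_deriv
  have hBd' : ∀ v, B v d = 0 := fun v => by rw [hB, schrForm_comm]; exact hBd v
  have hBχ : ∀ v, B χ v = (3 * a - 6 * κ₀) * l2Form T χ v := hr.schrForm_sqAdd h₀
  have hBχ' : ∀ v, B v χ = (3 * a - 6 * κ₀) * l2Form T χ v := fun v => by
    rw [hB, schrForm_comm]; exact hBχ v
  have hχd : l2Form T χ d = 0 := by
    have := hBχ d
    rw [hBd'] at this
    exact (mul_eq_zero.1 this.symm).resolve_left hl₀.ne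
  have hBk : B k k = B h h + β ^ 2 * ((3 * a - 6 * κ₀) * l2Form T χ χ) := by
    simp only [hk, map_sub, map_smul, LinearMap.sub_apply, LinearMap.smul_apply, smul_eq_mul, hBd,
      hBd', hBχ, hBχ', hχ]
    ring
  have hGk : l2Form T k k = l2Form T h h + β ^ 2 * l2Form T χ χ + γ ^ 2 * l2Form T d d := by
    simp only [hk, map_sub, map_smul, LinearMap.sub_apply, LinearMap.smul_apply, smul_eq_mul,
      l2Form_comm h χ, l2Form_comm h d, l2Form_comm d χ, hχ, hχd, hd]
    ring
  have p1 := mul_nonneg hl₂.le (mul_nonneg (sq_nonneg β) (l2Form_self_nonneg hT.le χ))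
  have p2 := mul_nonneg hl₂.le (mul_nonneg (sq_nonneg γ) (l2Form_self_nonneg hT.le d))
  have p3 := mul_nonneg (by linarith : 0 ≤ -(3 * a - 6 * κ₀))
    (mul_nonneg (sq_nonneg β) (l2Form_self_nonneg hT.le χ))
  rw [hGk, hBk] at hkB
  linarith

end IsProfile

/-! ### Norm inequalities on a period -/

/-- The squared `H¹[0,T]` norm. -/
noncomputable def h1Sq {T : ℝ} (h : PerC1 T) : ℝ :=
  ∫ x in (0 : ℝ)..T, (deriv h.1 x ^ 2 + h.1 x ^ 2)

lemma l2Form_le_h1Sq {T : ℝ} (hT : 0 ≤ T) (h : PerC1 T) : l2Form T h h ≤ h1Sq h := by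
  have := PerC1.continuous h; have := PerC1.continuous_deriv h
  exact intervalIntegral.integral_mono_on hT (Continuous.intervalIntegrable (by fun_prop) _ _)
    (Continuous.intervalIntegrable (by fun_prop) _ _)
    fun x _ => by nlinarith [sq_nonneg (deriv h.1 x)]

/-- The `H¹` norm is controlled by the form of a Schrödinger operator and the `L²` norm. -/
lemma h1Sq_le {T C : ℝ} (hT : 0 ≤ T) (W : C(ℝ, ℝ)) (hW : ∀ x, W x + 1 ≤ C) (h : PerC1 T) :
    h1Sq h ≤ schrForm T W h h + C * l2Form T h h := by
  have := PerC1.continuous h; have := PerC1.continuous_deriv h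
  rw [schrForm_apply, l2Form_apply, ← intervalIntegral.integral_const_mul,
    ← intervalIntegral.integral_add (Continuous.intervalIntegrable (by fun_prop) _ _)
    (Continuous.intervalIntegrable (by fun_prop) _ _)]
  exact intervalIntegral.integral_mono_on hT (Continuous.intervalIntegrable (by fun_prop) _ _)
    (Continuous.intervalIntegrable (by fun_prop) _ _)
    fun x _ => by nlinarith [mul_le_mul_of_nonneg_right (hW x) (sq_nonneg (h.1 x))]

lemma abs_integral_le_of_mem_Icc {T z x : ℝ} {f : ℝ → ℝ} (hf : Continuous f)
    (hz : z ∈ Icc 0 T) (hx : x ∈ Icc 0 T) : |∫ y in z..x, f y| ≤ ∫ y in (0 : ℝ)..T, |f y| := by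
  refine (intervalIntegral.norm_integral_le_integral_norm_uIoc (f := f)).trans ?_
  rw [intervalIntegral.integral_of_le (hz.1.trans hz.2)]
  refine MeasureTheory.setIntegral_mono_set ?_ ?_ ?_
  · exact (hf.abs.integrableOn_Icc (a := 0) (b := T)).mono_set Ioc_subset_Icc_self
  · exact Filter.Eventually.of_forall fun _ => abs_nonneg _
  · refine (Ioc_subset_Ioc (le_min hz.1 hx.1) (max_le hz.2 hx.2)).eventuallyLE

lemma sq_integral_le {T : ℝ} (hT : 0 < T) {f : ℝ → ℝ} (hf : Continuous f) :
    (∫ x in (0 : ℝ)..T, f x) ^ 2 ≤ T * ∫ x in (0 : ℝ)..T, f x ^ 2 := by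
  set I := ∫ x in (0 : ℝ)..T, f x with hI
  have h0 : 0 ≤ ∫ x in (0 : ℝ)..T, (f x - I / T) ^ 2 :=
    intervalIntegral.integral_nonneg hT.le fun _ _ => sq_nonneg _
  have h1 : ∫ x in (0 : ℝ)..T, (f x - I / T) ^ 2 =
      (∫ x in (0 : ℝ)..T, f x ^ 2) - 2 * (I / T) * I + T * (I / T) ^ 2 := by
    have : ∀ x, (f x - I / T) ^ 2 = f x ^ 2 - 2 * (I / T) * f x + (I / T) ^ 2 := fun x => by ring
    simp_rw [this]
    rw [intervalIntegral.integral_add, intervalIntegral.integral_sub,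
      intervalIntegral.integral_const_mul, intervalIntegral.integral_const, ← hI]
    · simp
    all_goals exact Continuous.intervalIntegrable (by fun_prop) _ _
  rw [h1] at h0
  have h2 : T * ((∫ x in (0 : ℝ)..T, f x ^ 2) - 2 * (I / T) * I + T * (I / T) ^ 2) =
      T * (∫ x in (0 : ℝ)..T, f x ^ 2) - I ^ 2 := by
    field_simp
    ring
  have := mul_nonneg hT.le h0
  linarith

/-- The Sobolev inequality `‖h‖_∞² ≤ (1 + 1/T) ‖h‖²_{H¹}`. -/
lemma sq_le_h1Sq {T : ℝ} (hT : 0 < T) (h : PerC1 T) (x : ℝ) :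
    h.1 x ^ 2 ≤ (1 + 1 / T) * h1Sq h := by
  have hc := PerC1.continuous h
  have hc' := PerC1.continuous_deriv h
  obtain ⟨y, hy, hxy⟩ := (PerC1.periodic h).exists_mem_Ico₀ hT x
  rw [hxy]
  -- a point at which `h²` equals its mean value
  obtain ⟨z, hz, hz'⟩ : ∃ z ∈ Ioo 0 T, h.1 z ^ 2 = l2Form T h h / T := by
    have hd : ∀ x, HasDerivAt (fun x => (∫ s in (0 : ℝ)..x, h.1 s ^ 2) - l2Form T h h / T * x)
        (h.1 x ^ 2 - l2Form T h h / T) x := fun x =>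
      (((hc.pow 2).integral_hasStrictDerivAt 0 x).hasDerivAt.sub
        ((hasDerivAt_id x).const_mul (l2Form T h h / T))).congr_deriv (by simp)
    obtain ⟨z, hz, h0⟩ := exists_hasDerivAt_eq_zero hT
      (continuous_iff_continuousAt.2 fun x => (hd x).continuousAt).continuousOn (by
        rw [l2Form_apply]
        simp only [intervalIntegral.integral_same, mul_zero, sub_zero, ← sq]
        field_simp
        ring) fun x _ => hd x
    exact ⟨z, hz, by linarith⟩
  have hd : ∀ x, HasDerivAt (fun x => h.1 x ^ 2) (2 * h.1 x * deriv h.1 x) x := fun x => by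
    simpa using ((PerC1.differentiable h x).hasDerivAt).fun_pow 2
  have hftc : ∫ s in z..y, 2 * h.1 s * deriv h.1 s = h.1 y ^ 2 - h.1 z ^ 2 :=
    intervalIntegral.integral_eq_sub_of_hasDerivAt (fun x _ => hd x)
      (Continuous.intervalIntegrable (by fun_prop) _ _)
  have h1 := abs_integral_le_of_mem_Icc (f := fun s => 2 * h.1 s * deriv h.1 s) (by fun_prop)
    ⟨hz.1.le, hz.2.le⟩ ⟨hy.1, hy.2.le⟩
  have h2 : ∫ s in (0 : ℝ)..T, |2 * h.1 s * deriv h.1 s| ≤ h1Sq h :=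
    intervalIntegral.integral_mono_on hT.le (Continuous.intervalIntegrable (by fun_prop) _ _)
      (Continuous.intervalIntegrable (by fun_prop) _ _) fun s _ => by
        rw [abs_le]
        constructor <;> nlinarith [sq_nonneg (h.1 s + deriv h.1 s), sq_nonneg (h.1 s - deriv h.1 s)]
  have h3 := le_abs_self (∫ s in z..y, 2 * h.1 s * deriv h.1 s)
  have h4 : l2Form T h h / T ≤ h1Sq h / T :=
    div_le_div_of_nonneg_right (l2Form_le_h1Sq hT.le h) hT.le
  rw [hftc, hz'] at h3
  rw [hftc, hz'] at h1
  have h5 := h1.trans h2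
  have : (1 + 1 / T) * h1Sq h = h1Sq h + h1Sq h / T := by ring
  linarith

/-! ### Coercivity of the second variation -/

namespace IsProfile

variable {a c T : ℝ} {r : ℝ → ℝ}

lemma le_sq (hr : IsProfile a c T r) (ha : a < 0) (x : ℝ) : c / a ≤ r x ^ 2 := by
  rw [div_le_iff_of_neg ha]
  nlinarith [hr.energy x, sq_nonneg (deriv r x), sq_nonneg (r x ^ 2)]

/-- Coercivity of `-∂² - a - 6 r²` on the orthogonal complement of `r'`, up to the square of
`⟨r, ·⟩`. -/
lemma exists_coercive_real (hr : IsProfile a c T r) (ha : a < 0) (hc₀ : -(a ^ 2 / 4) < c)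
    (hc : c < 0) :
    ∃ m > 0, ∃ N > 0, ∀ h : PerC1 T, l2Form T hr.derivPerC1 h = 0 →
      m * h1Sq h ≤ schrForm T (potential a 6 hr.continuous) h h +
        N * l2Form T hr.toPerC1 h ^ 2 := by
  have hT := hr.pos
  -- the roots `κ` of `3 κ² - 2 a κ - c`
  obtain ⟨S, hS⟩ : ∃ S, S = √(a ^ 2 + 3 * c) := ⟨_, rfl⟩
  have hS2 : S ^ 2 = a ^ 2 + 3 * c := by rw [hS]; exact Real.sq_sqrt (by nlinarith)
  have hS0 : 0 ≤ S := by rw [hS]; exact Real.sqrt_nonneg _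
  -- the lower bound on `c` is what makes the third eigenvalue `a + 2 S` positive
  have hSa : -a < 2 * S := by
    by_contra! h
    nlinarith
  have hl₀ : 3 * a - 6 * ((a + S) / 3) < 0 := by linarith
  have hl₂ : 0 < 3 * a - 6 * ((a - S) / 3) := by linarith
  have h₀ : 3 * ((a + S) / 3) ^ 2 - 2 * a * ((a + S) / 3) - c = 0 := by
    linear_combination hS2 / 3
  have h₂ : 3 * ((a - S) / 3) ^ 2 - 2 * a * ((a - S) / 3) - c = 0 := by
    linear_combination hS2 / 3
  obtain ⟨p, -, hp', hp⟩ := hr.exists_half_period ha hc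
  have hd0 := hp (p + T / 4) ⟨by linarith, by linarith⟩
  obtain ⟨x₀, x₁, -, -, hx₀, -⟩ := hr.exists_level_points ha hc (ρ := -((a - S) / 3)) (by nlinarith)
  obtain ⟨m, hm, N, hN, h⟩ := exists_coercive_of_index_one (l2Form T)
    (schrForm T (potential a 6 hr.continuous)) l2Form_comm (schrForm_comm _)
    (l2Form_self_nonneg hT.le) hl₀ hl₂ (hr.schrForm_sqAdd h₀)
    (l2Form_self_pos hT _ (x := x₀) (by
      change r x₀ ^ 2 + (a + S) / 3 ≠ 0
      rw [hx₀]
      have : 0 < S := by linarith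
      intro h
      linarith))
    hr.schrForm_deriv (l2Form_self_pos hT _ hd0) (hr.schrForm_invProfile ha hc₀ hc)
    (hr.l2Form_invProfile_neg ha hc₀ hc)
    (hr.schrForm_ge_of_orthogonal ha h₀ h₂ (by linarith) (by linarith) hl₀ hl₂ hc)
  have hC : 0 < 1 + (1 - 5 * a) / m := by
    have : 0 < 1 - 5 * a := by linarith
    positivity
  refine ⟨1 / (1 + (1 - 5 * a) / m), by positivity, N, hN, fun k hk => ?_⟩
  have h1 := h k hk
  have h2 := h1Sq_le hT.le (potential a 6 hr.continuous) (C := 1 - 5 * a) (fun x => by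
    have := hr.sq_lt hc x
    rw [potential_apply]
    linarith) k
  rw [one_div_mul_eq_div, div_le_iff₀ hC]
  have h3 : l2Form T k k ≤ (schrForm T (potential a 6 hr.continuous) k k +
      N * l2Form T hr.toPerC1 k ^ 2) / m := by rw [le_div_iff₀ hm]; linarith
  have h4 := mul_le_mul_of_nonneg_left h3 (by linarith : 0 ≤ 1 - 5 * a)
  have h5 : 0 ≤ N * l2Form T hr.toPerC1 k ^ 2 := by positivity
  calc h1Sq k ≤ _ := h2
    _ ≤ _ := add_le_add (le_add_of_nonneg_right h5) h4
    _ = _ := by ring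

/-- The form of `-∂² - a - 2 r²` is `∫ (h' - (r'/r) h)²`. -/
lemma schrForm_two_eq (hr : IsProfile a c T r) (hc : c < 0) (h : PerC1 T) :
    schrForm T (potential a 2 hr.continuous) h h =
      ∫ x in (0 : ℝ)..T, (deriv h.1 x - deriv r x / r x * h.1 x) ^ 2 := by
  have h0 := hr.ne_zero hc
  have hrc := hr.continuous; have hrc' := hr.continuous_deriv
  have hhc := PerC1.continuous h; have hhc' := PerC1.continuous_deriv h
  have hq : Continuous fun x => deriv r x / r x := hrc'.div hrc h0
  have hq' : Continuous fun x => -r x ^ 2 - c / r x ^ 2 :=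
    (hrc.pow 2).neg.sub (continuous_const.div (hrc.pow 2) fun x => pow_ne_zero 2 (h0 x))
  have key := integral_deriv_eq_zero_of_periodic (T := T)
    (f := fun x => deriv r x / r x * h.1 x ^ 2)
    (f' := fun x => (-r x ^ 2 - c / r x ^ 2) * h.1 x ^ 2 +
      deriv r x / r x * (2 * h.1 x * deriv h.1 x))
    (fun x => by
      refine (((hr.hasDerivAt_deriv x).div (hr.hasDerivAt x) (h0 x)).mul
        ((PerC1.differentiable h x).hasDerivAt.fun_pow 2)).congr_deriv ?_
      have := h0 x
      simp only [Pi.div_apply]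
      norm_num
      left
      field_simp
      linear_combination -hr.energy x)
    (by fun_prop)
    (fun x => by
      simp only [hr.periodic x, hr.periodic_deriv x, PerC1.periodic h x])
  rw [schrForm_apply, ← sub_eq_zero, ← intervalIntegral.integral_sub]
  · refine Eq.trans ?_ key
    refine intervalIntegral.integral_congr fun x _ => ?_
    have := h0 x
    simp only [potential_apply]
    field_simp
    linear_combination (-h.1 x ^ 2) * hr.energy x
  · exact Continuous.intervalIntegrable (by fun_prop) _ _
  · exact Continuous.intervalIntegrable (by fun_prop) _ _

/-- Coercivity of `-∂² - a - 2 r²` on the orthogonal complement of its ground state `r`: if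
`h ⊥ r`, then `w = h / r` has a zero, and `∫ r² w'²` controls `w`. -/
lemma exists_coercive_imag (hr : IsProfile a c T r) (ha : a < 0) (hc : c < 0) :
    ∃ m > 0, ∀ h : PerC1 T, l2Form T hr.toPerC1 h = 0 →
      m * h1Sq h ≤ schrForm T (potential a 2 hr.continuous) h h := by
  have hT := hr.pos
  have h0 := hr.ne_zero hc
  have hrc := hr.continuous; have hrc' := hr.continuous_deriv
  have hca : 0 < c / a := div_pos_of_neg_of_neg hc ha
  obtain ⟨C, hC⟩ : ∃ C, C = T * (-a * (T * (1 / (c / a)))) := ⟨_, rfl⟩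
  have hC0 : 0 < C := by
    have : 0 < -a := by linarith
    rw [hC]; positivity
  have hD : 0 < 1 + (1 - a) * C := by
    have : 0 < 1 - a := by linarith
    positivity
  refine ⟨1 / (1 + (1 - a) * C), by positivity, fun h hh => ?_⟩
  have hhc := PerC1.continuous h; have hhc' := PerC1.continuous_deriv h
  set b := schrForm T (potential a 2 hr.continuous) h h with hb
  obtain ⟨z, hz, hz0⟩ : ∃ z ∈ Ioo 0 T, h.1 z = 0 := by
    have hd : ∀ x, HasDerivAt (fun x => ∫ s in (0 : ℝ)..x, r s * h.1 s) (r x * h.1 x) x :=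
      fun x => ((hrc.mul hhc).integral_hasStrictDerivAt 0 x).hasDerivAt
    obtain ⟨z, hz, e⟩ := exists_hasDerivAt_eq_zero hT
      (continuous_iff_continuousAt.2 fun x => (hd x).continuousAt).continuousOn (by
        simp only [intervalIntegral.integral_same]
        exact hh.symm) fun x _ => hd x
    exact ⟨z, hz, (mul_eq_zero.1 e).resolve_left (h0 z)⟩
  set w' : ℝ → ℝ := fun x => (deriv h.1 x * r x - h.1 x * deriv r x) / r x ^ 2 with hw'
  have hw : ∀ x, HasDerivAt (fun x => h.1 x / r x) (w' x) x := fun x =>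
    (PerC1.differentiable h x).hasDerivAt.div (hr.hasDerivAt x) (h0 x)
  have hwc : Continuous w' := (by fun_prop : Continuous fun x =>
    deriv h.1 x * r x - h.1 x * deriv r x).div (hrc.pow 2) fun x => pow_ne_zero 2 (h0 x)
  have hwb : ∫ x in (0 : ℝ)..T, w' x ^ 2 ≤ 1 / (c / a) * b := by
    have hq : Continuous fun x => deriv r x / r x := hrc'.div hrc h0
    rw [hb, hr.schrForm_two_eq hc, ← intervalIntegral.integral_const_mul]
    refine intervalIntegral.integral_mono_on hT.le
      (Continuous.intervalIntegrable (by fun_prop) _ _)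
      (Continuous.intervalIntegrable (by fun_prop) _ _) fun x _ => ?_
    have h1 := hr.le_sq ha x
    have h2 : deriv h.1 x - deriv r x / r x * h.1 x = r x * w' x := by
      have := h0 x
      simp only [hw']
      field_simp
    rw [h2, one_div_mul_eq_div, le_div_iff₀ hca, mul_pow, mul_comm]
    exact mul_le_mul_of_nonneg_right h1 (sq_nonneg _)
  have hpt : ∀ x ∈ Icc 0 T, h.1 x * h.1 x ≤ -a * (T * (1 / (c / a) * b)) := by
    intro x hx
    have hftc : ∫ s in z..x, w' s = h.1 x / r x := by
      rw [intervalIntegral.integral_eq_sub_of_hasDerivAt (fun x _ => hw x)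
        (hwc.intervalIntegrable _ _), hz0, zero_div, sub_zero]
    have h1 := abs_integral_le_of_mem_Icc hwc ⟨hz.1.le, hz.2.le⟩ hx
    have h2 := sq_integral_le hT hwc.abs
    simp only [sq_abs] at h2
    rw [hftc] at h1
    have h3 : (h.1 x / r x) ^ 2 ≤ T * (1 / (c / a) * b) := by
      rw [← sq_abs]
      exact (pow_le_pow_left₀ (abs_nonneg _) h1 2).trans
        (h2.trans (mul_le_mul_of_nonneg_left hwb hT.le))
    have h4 := hr.sq_lt hc x
    have h5 : h.1 x * h.1 x = r x ^ 2 * (h.1 x / r x) ^ 2 := by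
      have := h0 x
      field_simp
    rw [h5]
    exact mul_le_mul h4.le h3 (sq_nonneg _) (by linarith)
  have hG : l2Form T h h ≤ C * b := by
    rw [l2Form_apply]
    refine (intervalIntegral.integral_mono_on hT.le
      (Continuous.intervalIntegrable (by fun_prop) _ _)
      (Continuous.intervalIntegrable continuous_const _ _) hpt).trans_eq ?_
    rw [intervalIntegral.integral_const, hC, smul_eq_mul]
    ring
  have h2 := h1Sq_le hT.le (potential a 2 hr.continuous) (C := 1 - a) (fun x => by
    have := hr.sq_lt hc x
    rw [potential_apply]
    linarith) h
  have h4 := mul_le_mul_of_nonneg_left hG (by linarith : 0 ≤ 1 - a)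
  rw [one_div_mul_eq_div, div_le_iff₀ hD]
  linarith

end IsProfile

/-! ### The energy at the profile -/

/-- The functional `∫ (|g'|² - |g|⁴ - a |g|²)` of `g = u + i v`. -/
noncomputable def pairEnergy {T : ℝ} (a : ℝ) (u v : PerC1 T) : ℝ :=
  ∫ x in (0 : ℝ)..T, (deriv u.1 x ^ 2 + deriv v.1 x ^ 2 - (u.1 x ^ 2 + v.1 x ^ 2) ^ 2 -
    a * (u.1 x ^ 2 + v.1 x ^ 2))

namespace IsProfile

variable {a c T : ℝ} {r : ℝ → ℝ}

/-- `r` is in the kernel of `-∂² - a - 2 r²`. -/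
lemma schrForm_profile (hr : IsProfile a c T r) (v : PerC1 T) :
    schrForm T (potential a 2 hr.continuous) hr.toPerC1 v = 0 := by
  have := hr.continuous
  rw [schrForm_eq_integral _ _ hr.hasDerivAt hr.hasDerivAt_deriv (f := fun _ => 0)]
  · simp
  · fun_prop
  · intro x
    simp only [potential_apply, toPerC1]
    ring

/-- Taylor expansion of the pairEnergy at the profile. -/
lemma energy_expand (hr : IsProfile a c T r) (h k : PerC1 T) :
    pairEnergy a (hr.toPerC1 + h) k - pairEnergy a hr.toPerC1 0 =
      schrForm T (potential a 6 hr.continuous) h h +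
      schrForm T (potential a 2 hr.continuous) k k -
      ∫ x in (0 : ℝ)..T, (4 * r x * h.1 x * (h.1 x ^ 2 + k.1 x ^ 2) +
        (h.1 x ^ 2 + k.1 x ^ 2) ^ 2) := by
  have := hr.continuous; have := hr.continuous_deriv
  have := PerC1.continuous h; have := PerC1.continuous_deriv h
  have := PerC1.continuous k; have := PerC1.continuous_deriv k
  have hcrit := hr.schrForm_profile h
  have e : ∀ x, deriv (hr.toPerC1 + h).1 x = deriv r x + deriv h.1 x :=
    PerC1.deriv_add hr.toPerC1 h
  have e0 : pairEnergy a hr.toPerC1 0 =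
      ∫ x in (0 : ℝ)..T, (deriv r x ^ 2 - r x ^ 4 - a * r x ^ 2) := by
    refine intervalIntegral.integral_congr fun x _ => ?_
    have : deriv (0 : PerC1 T).1 x = 0 := by
      change deriv (fun _ : ℝ => (0 : ℝ)) x = 0
      simp
    simp only [this]
    simp only [toPerC1, ZeroMemClass.coe_zero, Pi.zero_apply]
    ring
  suffices pairEnergy a (hr.toPerC1 + h) k - pairEnergy a hr.toPerC1 0 =
      schrForm T (potential a 6 hr.continuous) h h +
      2 * schrForm T (potential a 2 hr.continuous) hr.toPerC1 h +
      schrForm T (potential a 2 hr.continuous) k k -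
      ∫ x in (0 : ℝ)..T, (4 * r x * h.1 x * (h.1 x ^ 2 + k.1 x ^ 2) +
        (h.1 x ^ 2 + k.1 x ^ 2) ^ 2) by
    rw [this, hcrit]
    ring
  rw [e0, schrForm_apply, schrForm_apply, schrForm_apply, ← intervalIntegral.integral_const_mul,
    ← intervalIntegral.integral_add, ← intervalIntegral.integral_add,
    ← intervalIntegral.integral_sub, pairEnergy, ← intervalIntegral.integral_sub]
  · refine intervalIntegral.integral_congr fun x _ => ?_
    simp only [e]
    simp only [potential_apply, toPerC1, Submodule.coe_add, Pi.add_apply]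
    ring
  · have := PerC1.continuous (hr.toPerC1 + h)
    have := PerC1.continuous_deriv (hr.toPerC1 + h)
    exact Continuous.intervalIntegrable (by fun_prop) _ _
  all_goals
    try simp only [toPerC1]
    exact Continuous.intervalIntegrable (by fun_prop) _ _

/-- The energy dominates the `H¹` distance to the profile, for perturbations which are small in
`L²`, preserve the mass, and are orthogonal to the directions `r'` and `i r` tangent to the orbit.
Preservation of the mass makes `⟨r, h⟩` quadratically small. -/
theorem exists_energy_lower_bound (hr : IsProfile a c T r) (ha : a < 0)
    (hc₀ : -(a ^ 2 / 4) < c) (hc : c < 0) :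
    ∃ m > 0, ∃ δ > 0, ∀ h k : PerC1 T, l2Form T hr.derivPerC1 h = 0 →
      l2Form T hr.toPerC1 k = 0 →
      2 * l2Form T hr.toPerC1 h + l2Form T h h + l2Form T k k = 0 →
      l2Form T h h + l2Form T k k ≤ δ →
      m * (h1Sq h + h1Sq k) ≤ pairEnergy a (hr.toPerC1 + h) k - pairEnergy a hr.toPerC1 0 := by
  have hT := hr.pos
  obtain ⟨m₁, hm₁, N, hN, hreal⟩ := hr.exists_coercive_real ha hc₀ hc
  obtain ⟨m₂, hm₂, himag⟩ := hr.exists_coercive_imag ha hc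
  obtain ⟨m, hm⟩ : ∃ m, m = min m₁ m₂ := ⟨_, rfl⟩
  have hm0 : 0 < m := by rw [hm]; exact lt_min hm₁ hm₂
  have ha' : 0 < -a := by linarith
  obtain ⟨ε, hε⟩ : ∃ ε, ε = m / (8 * -a) := ⟨_, rfl⟩
  have hε0 : 0 < ε := by rw [hε]; positivity
  have hεa : 2 * ε * -a = m / 4 := by rw [hε]; have := ha.ne; field_simp; norm_num
  obtain ⟨K, hK⟩ : ∃ K, K = 1 + 1 / T := ⟨_, rfl⟩
  have hK0 : 0 < K := by rw [hK]; positivity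
  obtain ⟨D, hD⟩ : ∃ D, D = (2 / ε + 1) * K + N / 4 := ⟨_, rfl⟩
  have hD0 : 0 < D := by rw [hD]; positivity
  refine ⟨m / 2, by positivity, m / (4 * D), by positivity, fun h k hh hk hmass hsmall => ?_⟩
  have hrc := hr.continuous
  have hhc := PerC1.continuous h; have hkc := PerC1.continuous k
  obtain ⟨H, hH⟩ : ∃ H, H = h1Sq h + h1Sq k := ⟨_, rfl⟩
  obtain ⟨S, hS⟩ : ∃ S, S = l2Form T h h + l2Form T k k := ⟨_, rfl⟩
  have hSH : S ≤ H := by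
    rw [hS, hH]; exact add_le_add (l2Form_le_h1Sq hT.le h) (l2Form_le_h1Sq hT.le k)
  have hS0 : 0 ≤ S := by
    rw [hS]; exact add_nonneg (l2Form_self_nonneg hT.le h) (l2Form_self_nonneg hT.le k)
  have hH0 : 0 ≤ H := hS0.trans hSH
  have hSint : S = ∫ x in (0 : ℝ)..T, (h.1 x ^ 2 + k.1 x ^ 2) := by
    rw [hS, l2Form_apply, l2Form_apply, ← intervalIntegral.integral_add
      (Continuous.intervalIntegrable (by fun_prop) _ _)
      (Continuous.intervalIntegrable (by fun_prop) _ _)]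
    exact intervalIntegral.integral_congr fun x _ => by ring
  have hrem : ∫ x in (0 : ℝ)..T, (4 * r x * h.1 x * (h.1 x ^ 2 + k.1 x ^ 2) +
        (h.1 x ^ 2 + k.1 x ^ 2) ^ 2) ≤ (m / 4 + (2 / ε + 1) * (K * H)) * S := by
    rw [hSint, ← intervalIntegral.integral_const_mul]
    refine intervalIntegral.integral_mono_on hT.le
      (Continuous.intervalIntegrable (by fun_prop) _ _)
      (Continuous.intervalIntegrable (by fun_prop) _ _) fun x _ => ?_
    set s := h.1 x ^ 2 + k.1 x ^ 2 with hs
    have hs0 : 0 ≤ s := by positivity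
    have hsK : s ≤ K * H := by
      rw [hH, hK, mul_add]
      exact add_le_add (sq_le_h1Sq hT h x) (sq_le_h1Sq hT k x)
    -- `ε` gives the term quadratic in `h` a coefficient that the coercivity absorbs; the term
    -- quartic in `h` is small because `S` is.
    have h1 : 4 * r x * h.1 x * s ≤ 2 * ε * (r x ^ 2 * h.1 x ^ 2) + 2 / ε * (s * s) := by
      have h2 : 0 ≤ 2 / ε * (ε * (r x * h.1 x) - s) ^ 2 := by positivity
      have h3 : 2 / ε * (ε * (r x * h.1 x) - s) ^ 2 =
          2 * ε * (r x ^ 2 * h.1 x ^ 2) + 2 / ε * (s * s) - 4 * r x * h.1 x * s := by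
        field_simp
        ring
      linarith
    have h4 : r x ^ 2 * h.1 x ^ 2 ≤ -a * s :=
      mul_le_mul (hr.sq_lt hc x).le (by rw [hs]; linarith [sq_nonneg (k.1 x)]) (sq_nonneg _)
        ha'.le
    have h5 : s * s ≤ K * H * s := mul_le_mul_of_nonneg_right hsK hs0
    have h6 := mul_le_mul_of_nonneg_left h4 (by positivity : 0 ≤ 2 * ε)
    have h7 := mul_le_mul_of_nonneg_left h5 (by positivity : 0 ≤ 2 / ε)
    have h8 : 2 * ε * (-a * s) = m / 4 * s := by rw [← hεa]; ring
    nlinarith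
  have hr1 := hreal h hh
  have hi1 := himag k hk
  have hρ : l2Form T hr.toPerC1 h ^ 2 = S * S / 4 := by
    have : l2Form T hr.toPerC1 h = -S / 2 := by rw [hS]; linarith
    rw [this]; ring
  have hnn : ∀ g : PerC1 T, 0 ≤ h1Sq g := fun g =>
    (l2Form_self_nonneg hT.le g).trans (l2Form_le_h1Sq hT.le g)
  have hmm1 : m * h1Sq h ≤ m₁ * h1Sq h :=
    mul_le_mul_of_nonneg_right (by rw [hm]; exact min_le_left _ _) (hnn h)
  have hmm2 : m * h1Sq k ≤ m₂ * h1Sq k :=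
    mul_le_mul_of_nonneg_right (by rw [hm]; exact min_le_right _ _) (hnn k)
  rw [hρ] at hr1
  rw [hr.energy_expand, ← hH]
  have hDS : D * S ≤ m / 4 := by
    rw [← hS] at hsmall
    calc D * S ≤ D * (m / (4 * D)) := mul_le_mul_of_nonneg_left hsmall hD0.le
      _ = m / 4 := by field_simp
  have hDSH := mul_le_mul_of_nonneg_right hDS hH0
  have e1 : D * S * H = (2 / ε + 1) * (K * H) * S + N * (S * H / 4) := by rw [hD]; ring
  have e2 : N * (S * S / 4) ≤ N * (S * H / 4) := by gcongr
  have e3 : m / 4 * S ≤ m / 4 * H := by gcongr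
  have e4 : m * H = m * h1Sq h + m * h1Sq k := by rw [hH]; ring
  linarith

end IsProfile

/-! ### Modulation -/

/-- Translation of a periodic function. -/
noncomputable def shift {T : ℝ} (z : ℝ) (u : PerC1 T) : PerC1 T :=
  ⟨fun x => u.1 (x + z), (PerC1.contDiff u).comp (contDiff_id.add contDiff_const), fun x => by
    simp only [add_right_comm x T z, PerC1.periodic u (x + z)]⟩

/-- The real part of `e^{-iθ} (u + i v)(· + z)`. -/
noncomputable def rotRe {T : ℝ} (θ z : ℝ) (u v : PerC1 T) : PerC1 T :=
  Real.cos θ • shift z u + Real.sin θ • shift z v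

/-- The imaginary part of `e^{-iθ} (u + i v)(· + z)`. -/
noncomputable def rotIm {T : ℝ} (θ z : ℝ) (u v : PerC1 T) : PerC1 T :=
  Real.cos θ • shift z v - Real.sin θ • shift z u

section

variable {T : ℝ} (θ z : ℝ) (u v : PerC1 T) (x : ℝ)

lemma rotRe_apply : (rotRe θ z u v).1 x =
    Real.cos θ * u.1 (x + z) + Real.sin θ * v.1 (x + z) := rfl

lemma rotIm_apply : (rotIm θ z u v).1 x =
    Real.cos θ * v.1 (x + z) - Real.sin θ * u.1 (x + z) := rfl

lemma hasDerivAt_shift : HasDerivAt (fun x => u.1 (x + z)) (deriv u.1 (x + z)) x :=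
  (PerC1.differentiable u (x + z)).hasDerivAt.comp_add_const x z

lemma deriv_rotRe : deriv (rotRe θ z u v).1 x =
    Real.cos θ * deriv u.1 (x + z) + Real.sin θ * deriv v.1 (x + z) :=
  (((hasDerivAt_shift z u x).const_mul (Real.cos θ)).add
    ((hasDerivAt_shift z v x).const_mul (Real.sin θ))).deriv

lemma deriv_rotIm : deriv (rotIm θ z u v).1 x =
    Real.cos θ * deriv v.1 (x + z) - Real.sin θ * deriv u.1 (x + z) :=
  (((hasDerivAt_shift z v x).const_mul (Real.cos θ)).sub
    ((hasDerivAt_shift z u x).const_mul (Real.sin θ))).deriv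

end

lemma integral_comp_add_of_periodic {T : ℝ} {f : ℝ → ℝ} (hf : Function.Periodic f T) (z : ℝ) :
    ∫ x in (0 : ℝ)..T, f (x + z) = ∫ x in (0 : ℝ)..T, f x := by
  rw [intervalIntegral.integral_comp_add_right, zero_add, add_comm T z,
    hf.intervalIntegral_add_eq z 0, zero_add]

lemma pairEnergy_rot {T : ℝ} (a θ z : ℝ) (u v : PerC1 T) :
    pairEnergy a (rotRe θ z u v) (rotIm θ z u v) = pairEnergy a u v := by
  have hu := PerC1.periodic u; have hu' := PerC1.periodic_deriv u
  have hv := PerC1.periodic v; have hv' := PerC1.periodic_deriv v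
  refine Eq.trans ?_ (integral_comp_add_of_periodic (fun x => ?_) z)
  swap
  · simp only [hu x, hu' x, hv x, hv' x]
  refine intervalIntegral.integral_congr fun x _ => ?_
  simp only [deriv_rotRe, deriv_rotIm, rotRe_apply, rotIm_apply]
  have h := Real.cos_sq_add_sin_sq θ
  generalize deriv u.1 (x + z) = p
  generalize deriv v.1 (x + z) = q
  generalize u.1 (x + z) = s
  generalize v.1 (x + z) = t
  generalize Real.cos θ = C at *
  generalize Real.sin θ = S at *
  have e1 : (C * p + S * q) ^ 2 + (C * q - S * p) ^ 2 = p ^ 2 + q ^ 2 := by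
    linear_combination (p ^ 2 + q ^ 2) * h
  have e2 : (C * s + S * t) ^ 2 + (C * t - S * s) ^ 2 = s ^ 2 + t ^ 2 := by
    linear_combination (s ^ 2 + t ^ 2) * h
  rw [e1, e2]

lemma l2Form_rot {T : ℝ} (θ z : ℝ) (u v : PerC1 T) :
    l2Form T (rotRe θ z u v) (rotRe θ z u v) + l2Form T (rotIm θ z u v) (rotIm θ z u v) =
      l2Form T u u + l2Form T v v := by
  have hu := PerC1.periodic u; have hv := PerC1.periodic v
  have huc := PerC1.continuous u; have hvc := PerC1.continuous v
  have h1 := PerC1.continuous (rotRe θ z u v); have h2 := PerC1.continuous (rotIm θ z u v)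
  simp only [l2Form_apply]
  rw [← intervalIntegral.integral_add (Continuous.intervalIntegrable (by fun_prop) _ _)
    (Continuous.intervalIntegrable (by fun_prop) _ _),
    ← intervalIntegral.integral_add (Continuous.intervalIntegrable (by fun_prop) _ _)
    (Continuous.intervalIntegrable (by fun_prop) _ _)]
  refine Eq.trans ?_ (integral_comp_add_of_periodic (fun x => ?_) z)
  swap
  · simp only [hu x, hv x]
  refine intervalIntegral.integral_congr fun x _ => ?_
  simp only [rotRe_apply, rotIm_apply]
  linear_combination (u.1 (x + z) ^ 2 + v.1 (x + z) ^ 2) * Real.cos_sq_add_sin_sq θ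

namespace IsProfile

variable {a c T : ℝ} {r : ℝ → ℝ}

lemma abs_deriv_le (hr : IsProfile a c T r) (ha : a < 0) (hc : c < 0) (x : ℝ) :
    |deriv r x| ≤ -a := by
  refine abs_le_of_sq_le_sq ?_ (by linarith)
  have h1 := hr.sq_lt hc x
  nlinarith [hr.energy x, sq_nonneg (r x ^ 2)]

lemma hasDerivAt_l2Form_shift (hr : IsProfile a c T r) (ha : a < 0) (hc : c < 0) (u : PerC1 T)
    (z : ℝ) : HasDerivAt (fun z => l2Form T hr.toPerC1 (shift z u))
      (-l2Form T hr.derivPerC1 (shift z u)) z := by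
  have hrc := hr.continuous; have hrc' := hr.continuous_deriv
  have huc := PerC1.continuous u
  have e1 : ∀ z, l2Form T hr.toPerC1 (shift z u) = ∫ x in (0 : ℝ)..T, r (x - z) * u.1 x := by
    intro z
    rw [← integral_comp_add_of_periodic (f := fun x => r (x - z) * u.1 x) (z := z)
      (fun x => by simp only [add_sub_right_comm x T z, hr.periodic _, PerC1.periodic u _])]
    refine intervalIntegral.integral_congr fun x _ => ?_
    simp [toPerC1, shift]
  have e2 : -l2Form T hr.derivPerC1 (shift z u) =
      ∫ x in (0 : ℝ)..T, -deriv r (x - z) * u.1 x := by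
    rw [← integral_comp_add_of_periodic (f := fun x => -deriv r (x - z) * u.1 x) (z := z)
      (fun x => by simp only [add_sub_right_comm x T z, hr.periodic_deriv _, PerC1.periodic u _]),
      l2Form_apply,
      ← intervalIntegral.integral_neg]
    refine intervalIntegral.integral_congr fun x _ => ?_
    simp [derivPerC1, shift]
  simp_rw [e1]
  rw [e2]
  refine (intervalIntegral.hasDerivAt_integral_of_dominated_loc_of_deriv_le
    (F' := fun z x => -deriv r (x - z) * u.1 x)
    (bound := fun x => -a * |u.1 x|) Filter.univ_mem ?_ ?_ ?_ ?_ ?_ ?_).2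
  · exact Filter.Eventually.of_forall fun z =>
      (by fun_prop : Continuous fun x => r (x - z) * u.1 x).aestronglyMeasurable
  · exact Continuous.intervalIntegrable (by fun_prop) _ _
  · exact (by fun_prop : Continuous fun x => -deriv r (x - z) * u.1 x).aestronglyMeasurable
  · refine Filter.Eventually.of_forall fun x _ z _ => ?_
    rw [Real.norm_eq_abs, abs_mul, abs_neg]
    exact mul_le_mul_of_nonneg_right (hr.abs_deriv_le ha hc _) (abs_nonneg _)
  · exact Continuous.intervalIntegrable (by fun_prop) _ _
  · refine Filter.Eventually.of_forall fun x _ z _ => ?_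
    have := ((hr.hasDerivAt (x - z)).comp z ((hasDerivAt_id z).const_sub x)).mul_const (u.1 x)
    simpa using this

/-- Modulation: a phase and a translation that bring `u + i v` closest to `r` in `L²` make it
orthogonal to the directions `r'` and `i r` tangent to the orbit of `r`. -/
lemma exists_modulation (hr : IsProfile a c T r) (ha : a < 0) (hc : c < 0) (u v : PerC1 T) :
    ∃ θ z, l2Form T hr.derivPerC1 (rotRe θ z u v) = 0 ∧ l2Form T hr.toPerC1 (rotIm θ z u v) = 0 ∧
      ∀ θ' z', l2Form T hr.toPerC1 (rotRe θ' z' u v) ≤ l2Form T hr.toPerC1 (rotRe θ z u v) := by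
  have hT := hr.pos
  set A : PerC1 T → ℝ → ℝ := fun u z => l2Form T hr.toPerC1 (shift z u) with hA
  have hAd := hr.hasDerivAt_l2Form_shift ha hc
  have hAc : ∀ u, Continuous (A u) := fun u =>
    continuous_iff_continuousAt.2 fun z => (hAd u z).continuousAt
  have hJ : ∀ θ z, l2Form T hr.toPerC1 (rotRe θ z u v) =
      Real.cos θ * A u z + Real.sin θ * A v z := fun θ z => by
    simp [rotRe, hA]
  have hAp : ∀ u, Function.Periodic (A u) T := fun u z => by
    have : shift (z + T) u = shift z u := by
      ext x
      change u.1 (x + (z + T)) = u.1 (x + z)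
      rw [← add_assoc, PerC1.periodic u]
    simp only [hA, this]
  obtain ⟨⟨θ, z⟩, -, hmax⟩ := (isCompact_Icc.prod isCompact_Icc :
    IsCompact (Icc 0 (2 * Real.pi) ×ˢ Icc 0 T)).exists_isMaxOn
    ⟨(0, 0), ⟨⟨le_rfl, by positivity⟩, ⟨le_rfl, hT.le⟩⟩⟩
    (f := fun p : ℝ × ℝ => Real.cos p.1 * A u p.2 + Real.sin p.1 * A v p.2)
    (by have := hAc u; have := hAc v; fun_prop)
  have hglob : ∀ θ' z', Real.cos θ' * A u z' + Real.sin θ' * A v z' ≤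
      Real.cos θ * A u z + Real.sin θ * A v z := by
    intro θ' z'
    have h1 := toIcoMod_mem_Ico Real.two_pi_pos 0 θ'
    have h2 := toIcoMod_mem_Ico hT 0 z'
    rw [zero_add] at h1 h2
    have h3 := hmax (show (toIcoMod Real.two_pi_pos 0 θ', toIcoMod hT 0 z') ∈
      Icc 0 (2 * Real.pi) ×ˢ Icc 0 T from ⟨⟨h1.1, h1.2.le⟩, ⟨h2.1, h2.2.le⟩⟩)
    have e1 : toIcoMod Real.two_pi_pos 0 θ' =
      θ' - (toIcoDiv Real.two_pi_pos 0 θ' : ℤ) * (2 * Real.pi) := by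
      rw [toIcoMod, zsmul_eq_mul]
    have e2 : ∀ u, A u (toIcoMod hT 0 z') = A u z' := fun u => by
      rw [toIcoMod]; exact (hAp u).sub_zsmul_eq _
    simp only [mem_ofPred_eq, e2] at h3
    rwa [e1, Real.cos_sub_int_mul_two_pi, Real.sin_sub_int_mul_two_pi] at h3
  refine ⟨θ, z, ?_, ?_, fun θ' z' => by rw [hJ, hJ]; exact hglob θ' z'⟩
  · have hd := ((hAd u z).const_mul (Real.cos θ)).add ((hAd v z).const_mul (Real.sin θ))
    have h0 := IsLocalMax.hasDerivAt_eq_zero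
      (Filter.Eventually.of_forall fun z' => hglob θ z') hd
    simp only [rotRe, map_add, map_smul, smul_eq_mul]
    linarith
  · have hd := ((Real.hasDerivAt_cos θ).mul_const (A u z)).add
      ((Real.hasDerivAt_sin θ).mul_const (A v z))
    have h0 := IsLocalMax.hasDerivAt_eq_zero
      (Filter.Eventually.of_forall fun θ' => hglob θ' z) hd
    simp only [rotIm, map_sub, map_smul, smul_eq_mul]
    linarith

/-- The energy dominates the `H¹` distance to the orbit of the profile, at fixed mass and close to
the orbit in `L²`. -/
theorem exists_orbital_lower_bound (hr : IsProfile a c T r) (ha : a < 0)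
    (hc₀ : -(a ^ 2 / 4) < c) (hc : c < 0) :
    ∃ m > 0, ∃ δ > 0, ∀ u v : PerC1 T,
      l2Form T u u + l2Form T v v = l2Form T hr.toPerC1 hr.toPerC1 →
      (∃ θ z, l2Form T (rotRe θ z u v - hr.toPerC1) (rotRe θ z u v - hr.toPerC1) +
        l2Form T (rotIm θ z u v) (rotIm θ z u v) ≤ δ) →
      ∃ θ z, m * (h1Sq (rotRe θ z u v - hr.toPerC1) + h1Sq (rotIm θ z u v)) ≤
        pairEnergy a u v - pairEnergy a hr.toPerC1 0 := by
  obtain ⟨m, hm, δ, hδ, H⟩ := hr.exists_energy_lower_bound ha hc₀ hc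
  refine ⟨m, hm, δ, hδ, fun u v hmass ⟨θ', z', hclose⟩ => ?_⟩
  obtain ⟨θ, z, hd, hi, hmax⟩ := hr.exists_modulation ha hc u v
  refine ⟨θ, z, ?_⟩
  set ρ := hr.toPerC1 with hρ
  have hexp : ∀ θ z, l2Form T (rotRe θ z u v - ρ) (rotRe θ z u v - ρ) +
      l2Form T (rotIm θ z u v) (rotIm θ z u v) =
      2 * l2Form T ρ ρ - 2 * l2Form T ρ (rotRe θ z u v) := fun θ z => by
    have h := l2Form_rot θ z u v
    simp only [map_sub, LinearMap.sub_apply, l2Form_comm (rotRe θ z u v) ρ]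
    linarith
  have hdr : l2Form T hr.derivPerC1 ρ = 0 := by
    have := hr.continuous; have := hr.continuous_deriv
    have h := integral_deriv_eq_zero_of_periodic (T := T) (hr.hasDerivAt_sqAdd 0) (by fun_prop)
      (PerC1.periodic (hr.sqAdd 0))
    have e : ∫ x in (0 : ℝ)..T, 2 * r x * deriv r x = 2 * l2Form T hr.derivPerC1 ρ := by
      rw [l2Form_apply, ← intervalIntegral.integral_const_mul]
      exact intervalIntegral.integral_congr fun x _ => by
        simp only [derivPerC1, hρ, toPerC1]; ring
    linarith
  have key := H (rotRe θ z u v - ρ) (rotIm θ z u v) (by rw [map_sub, hd, hdr, sub_zero]) hi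
    (by
      have := hexp θ z
      rw [map_sub]
      linarith)
    (by
      have h1 := hexp θ z
      have h2 := hexp θ' z'
      have h3 := hmax θ' z'
      linarith)
  rwa [add_sub_cancel, pairEnergy_rot] at key

end IsProfile

/-! ### Regularity of solutions -/

lemma fourierCoeff_lift {T : ℝ} (hT : 0 < T) [Fact (0 < T)] {f : ℝ → ℂ}
    (hp : Function.Periodic f T) (n : ℤ) : fourierCoeff hp.lift n = fourierCoeffOn hT f n := by
  rw [fourierCoeff_eq_intervalIntegral _ n 0, fourierCoeffOn_eq_integral, zero_add, sub_zero]
  congr 1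

/-- A periodic function with square summable coefficients `(1+n²)^{s/2} f̂(n)`, `s > 3/2`, is `C¹`:
by Cauchy-Schwarz, its differentiated Fourier series converges absolutely. -/
lemma contDiff_of_weighted {T s : ℝ} (hT : 0 < T) (hs : 3 / 2 < s) {f : ℝ → ℂ}
    (hf : Continuous f) (hp : Function.Periodic f T) (U : lp (fun _ : ℤ => ℂ) 2)
    (hU : ∀ n, U n = weighted s (fourierCoeffOn hT f) n) : ContDiff ℝ 1 f := by
  have : Fact (0 < T) := ⟨hT⟩
  set F : C(AddCircle T, ℂ) := ⟨hp.lift, by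
    refine (QuotientAddGroup.isQuotientMap_mk (N := AddSubgroup.zmultiples T)).continuous_iff.2 ?_
    exact hf⟩ with hF
  have hco : ∀ n, fourierCoeff F n = fourierCoeffOn hT f n := fun n => fourierCoeff_lift hT hp n
  -- the majorant of `(1+n²)^{1/2} |f̂(n)|`
  set b : ℤ → ℝ := fun n => ‖U n‖ ^ 2 + (1 + (n : ℝ) ^ 2) ^ (1 - s) with hb
  have hbs : Summable b := by
    refine Summable.add ?_ ?_
    · have := (memℓp_gen_iff (by norm_num : 0 < (2 : ENNReal).toReal)).1 (lp.memℓp U)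
      simpa using this
    · refine Summable.of_norm_bounded_eventually
        (Real.summable_abs_int_rpow (b := 2 * (s - 1)) (by linarith)) ?_
      have : ∀ᶠ n : ℤ in Filter.cofinite, n ≠ 0 := by
        simpa using (Set.finite_singleton (0 : ℤ)).compl_mem_cofinite
      filter_upwards [this] with n hn
      have hn' : 0 < |(n : ℝ)| := abs_pos.2 (Int.cast_ne_zero.2 hn)
      rw [Real.norm_of_nonneg (by positivity), show -(2 * (s - 1)) = 2 * (1 - s) by ring,
        Real.rpow_mul hn'.le]
      refine Real.rpow_le_rpow_of_nonpos (by positivity) ?_ (by linarith)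
      norm_num
  have hbn : ∀ n : ℤ, (1 + (n : ℝ) ^ 2) ^ (1 / 2 : ℝ) * ‖fourierCoeff F n‖ ≤ b n := by
    intro n
    have h1 : (0 : ℝ) < 1 + (n : ℝ) ^ 2 := by positivity
    have h2 : ‖U n‖ = (1 + (n : ℝ) ^ 2) ^ (s / 2) * ‖fourierCoeff F n‖ := by
      rw [hU, weighted, hco, norm_mul, Complex.norm_real, Real.norm_of_nonneg (by positivity)]
    have h3 : (1 + (n : ℝ) ^ 2) ^ (1 / 2 : ℝ) * ‖fourierCoeff F n‖ =
        ‖U n‖ * (1 + (n : ℝ) ^ 2) ^ ((1 - s) / 2) := by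
      rw [h2, show (1 / 2 : ℝ) = s / 2 + (1 - s) / 2 by ring, Real.rpow_add h1]
      ring
    have h4 : (1 + (n : ℝ) ^ 2) ^ (1 - s) = ((1 + (n : ℝ) ^ 2) ^ ((1 - s) / 2)) ^ 2 := by
      rw [← Real.rpow_mul_natCast h1.le]
      congr 1
      push_cast
      ring
    rw [h3, hb]
    simp only [h4]
    nlinarith [sq_nonneg (‖U n‖ - (1 + (n : ℝ) ^ 2) ^ ((1 - s) / 2)), norm_nonneg (U n),
      sq_nonneg (‖U n‖ + (1 + (n : ℝ) ^ 2) ^ ((1 - s) / 2))]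
  have hw : ∀ n : ℤ, |(n : ℝ)| ≤ (1 + (n : ℝ) ^ 2) ^ (1 / 2 : ℝ) ∧
      1 ≤ (1 + (n : ℝ) ^ 2) ^ (1 / 2 : ℝ) := by
    intro n
    rw [← Real.sqrt_eq_rpow]
    exact ⟨Real.abs_le_sqrt (by linarith), Real.one_le_sqrt.2 (by nlinarith [sq_nonneg (n : ℝ)])⟩
  have hcs : Summable (fourierCoeff F) := Summable.of_norm_bounded hbs fun n =>
    (le_mul_of_one_le_left (norm_nonneg _) (hw n).2).trans (hbn n)
  have hsum : ∀ x : ℝ, f x = ∑' n : ℤ, fourierCoeff F n • fourier n (x : AddCircle T) := fun x =>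
    ((has_pointwise_sum_fourier_series_of_summable hcs (x : AddCircle T)).tsum_eq).symm
  have hnf : ∀ (n : ℤ) (x : ℝ), ‖(fourier n (x : AddCircle T) : ℂ)‖ = 1 := fun n x => by
    rw [fourier_apply]; exact Circle.norm_coe _
  have hd : ∀ (n : ℤ) (x : ℝ), HasDerivAt
      (fun x : ℝ => fourierCoeff F n • (fourier n (x : AddCircle T) : ℂ))
      (fourierCoeff F n • (2 * Real.pi * Complex.I * n / T * fourier n (x : AddCircle T))) x :=
    fun n x => (hasDerivAt_fourier T n x).const_mul (fourierCoeff F n)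
  have hbd : ∀ (n : ℤ) (x : ℝ),
      ‖fourierCoeff F n • (2 * Real.pi * Complex.I * n / T * fourier n (x : AddCircle T))‖ ≤
        2 * Real.pi / T * b n := by
    intro n x
    rw [norm_smul, norm_mul, hnf, mul_one]
    have e : ‖(2 * Real.pi * Complex.I * n / T : ℂ)‖ = 2 * Real.pi / T * |(n : ℝ)| := by
      simp [abs_of_pos Real.pi_pos, abs_of_pos hT]
      ring
    rw [e]
    have h1 : |(n : ℝ)| * ‖fourierCoeff F n‖ ≤ b n :=
      (mul_le_mul_of_nonneg_right (hw n).1 (norm_nonneg _)).trans (hbn n)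
    calc _ = 2 * Real.pi / T * (|(n : ℝ)| * ‖fourierCoeff F n‖) := by ring
      _ ≤ _ := mul_le_mul_of_nonneg_left h1 (by positivity)
  have hbs' : Summable fun n => 2 * Real.pi / T * b n := hbs.mul_left _
  have hder : ∀ x : ℝ, HasDerivAt f (∑' n : ℤ,
      fourierCoeff F n • (2 * Real.pi * Complex.I * n / T * fourier n (x : AddCircle T))) x := by
    intro x
    rw [show f = fun x => _ from funext hsum]
    exact hasDerivAt_tsum hbs' hd hbd
      (has_pointwise_sum_fourier_series_of_summable hcs ((0 : ℝ) : AddCircle T)).summable x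
  rw [contDiff_one_iff_deriv]
  refine ⟨fun x => (hder x).differentiableAt, ?_⟩
  rw [funext fun x => (hder x).deriv]
  refine continuous_tsum (fun n => ?_) hbs' hbd
  have : Continuous fun x : ℝ => (fourier n (x : AddCircle T) : ℂ) :=
    continuous_iff_continuousAt.2 fun x => (hasDerivAt_fourier T n x).continuousAt
  fun_prop

lemma IsSolution.contDiff {T : ℝ} {hT : 0 < T} {s t₀ : ℝ} {u : ℝ → ℝ → ℂ}
    (h : IsSolution hT s t₀ u) (hs : 3 / 2 < s) {t : ℝ} (ht : t ∈ Ico 0 t₀) :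
    ContDiff ℝ 1 (u t) := by
  obtain ⟨U, hU, -⟩ := h.continuous_curve
  exact contDiff_of_weighted hT hs (h.continuous t ht) (h.periodic t ht) (U t) (hU t ht)

/-! ### The travelling wave and the conserved functionals -/

section

variable {T ω : ℝ} {f : ℝ → ℂ}

/-- The demodulated function `e^{-iωx} f(x)`. -/
noncomputable def demod (ω : ℝ) (f : ℝ → ℂ) (x : ℝ) : ℂ :=
  Complex.exp (-(Complex.I * ω * x)) * f x

lemma contDiff_demod (hf : ContDiff ℝ 1 f) : ContDiff ℝ 1 (demod ω f) := by
  have : ContDiff ℝ 1 fun x : ℝ => (x : ℂ) := Complex.ofRealCLM.contDiff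
  exact ((contDiff_const.mul this).neg.cexp).mul hf

lemma periodic_demod (hω : ∃ N : ℤ, ω * T = 2 * Real.pi * N) (hp : Function.Periodic f T) :
    Function.Periodic (demod ω f) T := by
  obtain ⟨N, hN⟩ := hω
  intro x
  have e : -(Complex.I * ω * (x + T : ℝ)) =
      -(Complex.I * ω * x) + ((-N : ℤ) : ℂ) * (2 * Real.pi * Complex.I) := by
    have : (ω : ℂ) * T = 2 * Real.pi * N := by exact_mod_cast hN
    push_cast
    linear_combination (-Complex.I) * this
  rw [demod, demod, hp, e, Complex.exp_add, Complex.exp_int_mul_two_pi_mul_I, mul_one]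

/-- The real part of `e^{-iωx} f(x)`. -/
noncomputable def demodRe (hω : ∃ N : ℤ, ω * T = 2 * Real.pi * N) (hf : ContDiff ℝ 1 f)
    (hp : Function.Periodic f T) : PerC1 T :=
  ⟨fun x => (demod ω f x).re, Complex.reCLM.contDiff.comp (contDiff_demod hf),
    fun x => by simp only [periodic_demod hω hp x]⟩

/-- The imaginary part of `e^{-iωx} f(x)`. -/
noncomputable def demodIm (hω : ∃ N : ℤ, ω * T = 2 * Real.pi * N) (hf : ContDiff ℝ 1 f)
    (hp : Function.Periodic f T) : PerC1 T :=
  ⟨fun x => (demod ω f x).im, Complex.imCLM.contDiff.comp (contDiff_demod hf),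
    fun x => by simp only [periodic_demod hω hp x]⟩

lemma norm_exp_I_mul (a b : ℝ) : ‖Complex.exp (Complex.I * a * b)‖ = 1 := by
  rw [show Complex.I * a * b = ((a * b : ℝ) : ℂ) * Complex.I by push_cast; ring,
    Complex.norm_exp_ofReal_mul_I]

variable (hω : ∃ N : ℤ, ω * T = 2 * Real.pi * N) (hf : ContDiff ℝ 1 f)
  (hp : Function.Periodic f T)

lemma eq_exp_mul_demod (x : ℝ) : f x = Complex.exp (Complex.I * ω * x) *
    ((demodRe hω hf hp).1 x + (demodIm hω hf hp).1 x * Complex.I) := by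
  have h1 : ((demodRe hω hf hp).1 x + (demodIm hω hf hp).1 x * Complex.I : ℂ) = demod ω f x :=
    Complex.re_add_im _
  rw [h1, demod, ← mul_assoc, ← Complex.exp_add, add_neg_cancel, Complex.exp_zero, one_mul]

/-- The derivative of `e^{i(ωx+θ)} (u + i v)`. -/
lemma hasDerivAt_exp_mul_pair (u v : PerC1 T) (ω θ z x : ℝ) :
    HasDerivAt (fun x : ℝ => Complex.exp (Complex.I * ω * (x + θ : ℝ)) *
        (u.1 (x + z) + v.1 (x + z) * Complex.I))
      (Complex.exp (Complex.I * ω * (x + θ : ℝ)) *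
        (((deriv u.1 (x + z) - ω * v.1 (x + z) : ℝ) : ℂ) +
          ((deriv v.1 (x + z) + ω * u.1 (x + z) : ℝ) : ℂ) * Complex.I)) x := by
  have h1 : HasDerivAt (fun x : ℝ => Complex.I * ω * ((x + θ : ℝ) : ℂ)) (Complex.I * ω) x := by
    simpa using (((hasDerivAt_id x).add_const θ).ofReal_comp).const_mul (Complex.I * ω)
  have h2 := (hasDerivAt_shift z u x).ofReal_comp.add
    ((hasDerivAt_shift z v x).ofReal_comp.mul_const Complex.I)
  refine (h1.cexp.mul h2).congr_deriv ?_
  simp only [Pi.add_apply]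
  push_cast
  linear_combination (Complex.exp (Complex.I * ω * (x + θ)) * ω * v.1 (x + z)) * Complex.I_mul_I

lemma deriv_eq_exp_mul_demod (x : ℝ) : deriv f x = Complex.exp (Complex.I * ω * x) *
    (((deriv (demodRe hω hf hp).1 x - ω * (demodIm hω hf hp).1 x : ℝ) : ℂ) +
      ((deriv (demodIm hω hf hp).1 x + ω * (demodRe hω hf hp).1 x : ℝ) : ℂ) * Complex.I) := by
  have h := (hasDerivAt_exp_mul_pair (demodRe hω hf hp) (demodIm hω hf hp) ω 0 0 x).deriv
  simp only [add_zero] at h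
  rw [← h]
  exact congrArg (fun g => deriv g x) (funext (eq_exp_mul_demod hω hf hp))

lemma sq_norm_exp_mul (a b p q : ℝ) :
    ‖Complex.exp (Complex.I * a * b) * ((p : ℂ) + q * Complex.I)‖ ^ 2 = p ^ 2 + q ^ 2 := by
  rw [norm_mul, norm_exp_I_mul, one_mul, ← Complex.normSq_eq_norm_sq, Complex.normSq_add_mul_I]

lemma P_eq : P T f = l2Form T (demodRe hω hf hp) (demodRe hω hf hp) +
    l2Form T (demodIm hω hf hp) (demodIm hω hf hp) := by
  have h1 := PerC1.continuous (demodRe hω hf hp)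
  have h2 := PerC1.continuous (demodIm hω hf hp)
  rw [P, l2Form_apply, l2Form_apply, ← intervalIntegral.integral_add
    (Continuous.intervalIntegrable (by fun_prop) _ _)
    (Continuous.intervalIntegrable (by fun_prop) _ _)]
  refine intervalIntegral.integral_congr fun x _ => ?_
  rw [eq_exp_mul_demod hω hf hp x, sq_norm_exp_mul]
  ring

/-- In terms of `g = e^{-iωx} f`, the functional `M` is `∫ (|g'|² - |g|⁴ - a |g|²)`. -/
lemma M_eq (a : ℝ) : M a ω T f = pairEnergy a (demodRe hω hf hp) (demodIm hω hf hp) := by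
  have hc := hf.continuous
  have hc' := hf.continuous_deriv le_rfl
  have hQ : Q T f =
      ∫ x in (0 : ℝ)..T, (Complex.I * ((starRingEnd ℂ) (deriv f x) * f x)).re := by
    rw [Q, ← intervalIntegral.integral_const_mul]
    refine (Complex.reCLM.intervalIntegral_comp_comm
      (Continuous.intervalIntegrable ?_ _ _)).symm
    exact continuous_const.mul ((Complex.continuous_conj.comp hc').mul hc)
  have hQc : Continuous fun x => (Complex.I * ((starRingEnd ℂ) (deriv f x) * f x)).re :=
    Complex.continuous_re.comp
      (continuous_const.mul ((Complex.continuous_conj.comp hc').mul hc))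
  rw [M, F, P, hQ, ← intervalIntegral.integral_const_mul, ← intervalIntegral.integral_const_mul,
    ← intervalIntegral.integral_add, ← intervalIntegral.integral_sub, pairEnergy]
  · refine intervalIntegral.integral_congr fun x _ => ?_
    have e1 := eq_exp_mul_demod hω hf hp x
    have e2 := deriv_eq_exp_mul_demod hω hf hp x
    have n1 : ‖f x‖ ^ 2 = (demodRe hω hf hp).1 x ^ 2 + (demodIm hω hf hp).1 x ^ 2 := by
      rw [e1, sq_norm_exp_mul]
    have n2 : ‖deriv f x‖ ^ 2 = (deriv (demodRe hω hf hp).1 x - ω * (demodIm hω hf hp).1 x) ^ 2 +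
        (deriv (demodIm hω hf hp).1 x + ω * (demodRe hω hf hp).1 x) ^ 2 := by
      rw [e2, sq_norm_exp_mul]
    have n3 : ‖f x‖ ^ 4 = (‖f x‖ ^ 2) ^ 2 := by ring
    have hexp : (starRingEnd ℂ) (Complex.exp (Complex.I * ω * x)) *
        Complex.exp (Complex.I * ω * x) = 1 := by
      rw [← Complex.exp_conj, ← Complex.exp_add]
      simp
    have n4 : (Complex.I * ((starRingEnd ℂ) (deriv f x) * f x)).re =
        (deriv (demodIm hω hf hp).1 x + ω * (demodRe hω hf hp).1 x) * (demodRe hω hf hp).1 x -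
        (deriv (demodRe hω hf hp).1 x - ω * (demodIm hω hf hp).1 x) *
          (demodIm hω hf hp).1 x := by
      rw [e2, congrArg (fun y => Complex.I * ((starRingEnd ℂ) _ * y)) e1, map_mul,
        mul_mul_mul_comm, hexp, one_mul]
      simp
      ring
    simp only [n3, n4, n1, n2]
    ring
  all_goals exact Continuous.intervalIntegrable (by fun_prop) _ _

end

section wave

variable {a c T ω : ℝ} {r : ℝ → ℝ}

lemma contDiff_wave (hr : IsProfile a c T r) (t : ℝ) : ContDiff ℝ 1 (wave a ω r t) := by
  have h1 : ContDiff ℝ 1 fun x : ℝ => (x : ℂ) := Complex.ofRealCLM.contDiff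
  have h2 : ContDiff ℝ 1 fun x : ℝ => x + (3 * a + ω ^ 2) * t := contDiff_id.add contDiff_const
  have h3 : ContDiff ℝ 1 fun x : ℝ => x + (a + 3 * ω ^ 2) * t := contDiff_id.add contDiff_const
  exact ((contDiff_const.mul (h1.comp h2)).cexp).mul
    (h1.comp ((hr.contDiff.of_le one_le_two).comp h3))

lemma periodic_wave (hr : IsProfile a c T r) (hω : ∃ N : ℤ, ω * T = 2 * Real.pi * N) (t : ℝ) :
    Function.Periodic (wave a ω r t) T := by
  obtain ⟨N, hN⟩ := hω
  intro x
  have e : Complex.I * ω * (x + T + (3 * a + ω ^ 2) * t : ℝ) =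
      Complex.I * ω * (x + (3 * a + ω ^ 2) * t : ℝ) + (N : ℂ) * (2 * Real.pi * Complex.I) := by
    have : (ω : ℂ) * T = 2 * Real.pi * N := by exact_mod_cast hN
    push_cast
    linear_combination Complex.I * this
  rw [wave, wave, e, Complex.exp_add, Complex.exp_int_mul_two_pi_mul_I, mul_one,
    show x + T + (a + 3 * ω ^ 2) * t = x + (a + 3 * ω ^ 2) * t + T by ring, hr.periodic]

lemma demod_wave (t x : ℝ) : demod ω (wave a ω r t) x =
    Complex.exp ((ω * ((3 * a + ω ^ 2) * t) : ℝ) * Complex.I) * r (x + (a + 3 * ω ^ 2) * t) := by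
  rw [demod, wave, ← mul_assoc, ← Complex.exp_add]
  congr 2
  push_cast
  ring

/-- Undoing the phase and the translation of the travelling wave gives back the profile. -/
lemma rot_wave (hr : IsProfile a c T r) (hω : ∃ N : ℤ, ω * T = 2 * Real.pi * N) (t : ℝ) :
    rotRe (ω * ((3 * a + ω ^ 2) * t)) (-((a + 3 * ω ^ 2) * t))
        (demodRe hω (contDiff_wave hr t) (periodic_wave hr hω t))
        (demodIm hω (contDiff_wave hr t) (periodic_wave hr hω t)) = hr.toPerC1 ∧
      rotIm (ω * ((3 * a + ω ^ 2) * t)) (-((a + 3 * ω ^ 2) * t))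
        (demodRe hω (contDiff_wave hr t) (periodic_wave hr hω t))
        (demodIm hω (contDiff_wave hr t) (periodic_wave hr hω t)) = 0 := by
  set θ := ω * ((3 * a + ω ^ 2) * t) with hθ
  have hre : ∀ x, (demodRe hω (contDiff_wave hr t) (periodic_wave hr hω t)).1 x =
      Real.cos θ * r (x + (a + 3 * ω ^ 2) * t) := fun x => by
    simp only [demodRe]
    rw [demod_wave, ← hθ, Complex.re_mul_ofReal, Complex.exp_ofReal_mul_I_re]
  have him : ∀ x, (demodIm hω (contDiff_wave hr t) (periodic_wave hr hω t)).1 x =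
      Real.sin θ * r (x + (a + 3 * ω ^ 2) * t) := fun x => by
    simp only [demodIm]
    rw [demod_wave, ← hθ, Complex.im_mul_ofReal, Complex.exp_ofReal_mul_I_im]
  constructor
  · ext x
    rw [rotRe_apply, hre, him, neg_add_cancel_right]
    change _ = r x
    linear_combination r x * Real.cos_sq_add_sin_sq θ
  · ext x
    rw [rotIm_apply, hre, him, neg_add_cancel_right]
    change _ = (0 : ℝ)
    ring

lemma P_wave (hr : IsProfile a c T r) (hω : ∃ N : ℤ, ω * T = 2 * Real.pi * N) (t : ℝ) :
    P T (wave a ω r t) = l2Form T hr.toPerC1 hr.toPerC1 := by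
  obtain ⟨h1, h2⟩ := rot_wave hr hω t
  rw [P_eq hω (contDiff_wave hr t) (periodic_wave hr hω t), ← l2Form_rot, h1, h2]
  simp

lemma M_wave (hr : IsProfile a c T r) (hω : ∃ N : ℤ, ω * T = 2 * Real.pi * N) (t : ℝ) :
    M a ω T (wave a ω r t) = pairEnergy a hr.toPerC1 0 := by
  obtain ⟨h1, h2⟩ := rot_wave hr hω t
  rw [M_eq hω (contDiff_wave hr t) (periodic_wave hr hω t), ← pairEnergy_rot, h1, h2]

variable {f : ℝ → ℂ}

/-- The difference between `f` and a point of the orbit of the wave, in terms of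
`h + i k = e^{-iθ} (e^{-iω·} f)(· + z) - r`. -/
lemma sub_wave_eq (hr : IsProfile a c T r) (hω : ∃ N : ℤ, ω * T = 2 * Real.pi * N)
    (hf : ContDiff ℝ 1 f) (hp : Function.Periodic f T) (t : ℝ) {θ z η ξ τ : ℝ}
    (hθ : θ = ω * τ) (hτ : τ = η - ξ + (3 * a + ω ^ 2) * t) (hz : z = ξ - (a + 3 * ω ^ 2) * t)
    (x : ℝ) :
    f x - Complex.exp (Complex.I * ω * η) * wave a ω r t (x - ξ) =
      Complex.exp (Complex.I * ω * (x + τ : ℝ)) *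
        ((rotRe θ z (demodRe hω hf hp) (demodIm hω hf hp) - hr.toPerC1).1 (x + -z) +
          (rotIm θ z (demodRe hω hf hp) (demodIm hω hf hp)).1 (x + -z) * Complex.I) := by
  have e1 : (rotRe θ z (demodRe hω hf hp) (demodIm hω hf hp) - hr.toPerC1).1 (x + -z) =
      Real.cos θ * (demodRe hω hf hp).1 x + Real.sin θ * (demodIm hω hf hp).1 x - r (x + -z) := by
    change (rotRe θ z (demodRe hω hf hp) (demodIm hω hf hp)).1 (x + -z) - r (x + -z) = _
    rw [rotRe_apply, neg_add_cancel_right]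
  rw [e1, rotIm_apply, neg_add_cancel_right, eq_exp_mul_demod hω hf hp x, wave, ← mul_assoc,
    ← Complex.exp_add, show x - ξ + (a + 3 * ω ^ 2) * t = x + -z by rw [hz]; ring,
    show Complex.I * ω * η + Complex.I * ω * (x - ξ + (3 * a + ω ^ 2) * t : ℝ) =
      Complex.I * ω * (x + τ : ℝ) by rw [hτ]; push_cast; ring]
  have e2 : Complex.exp (Complex.I * ω * (x + τ : ℝ)) =
      Complex.exp (Complex.I * ω * x) * (Real.cos θ + Real.sin θ * Complex.I) := by
    rw [Complex.ofReal_cos, Complex.ofReal_sin, ← Complex.exp_mul_I, ← Complex.exp_add, hθ]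
    congr 1
    push_cast
    ring
  have e3 : (Real.cos θ : ℂ) ^ 2 + (Real.sin θ : ℂ) ^ 2 = 1 := by
    exact_mod_cast Real.cos_sq_add_sin_sq θ
  rw [e2]
  simp only [Complex.ofReal_add, Complex.ofReal_sub, Complex.ofReal_mul]
  generalize (demodRe hω hf hp).1 x = p
  generalize (demodIm hω hf hp).1 x = q
  linear_combination (-Complex.exp (Complex.I * ω * x) * (p + q * Complex.I)) * e3 +
    (Complex.exp (Complex.I * ω * x) * ((Real.sin θ : ℂ) ^ 2 * p - Real.cos θ * Real.sin θ * q)) *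
      Complex.I_sq

/-- The function of `(η, ξ)` whose infimum defines `d_q(f, g)²`. -/
noncomputable def orbitDist (q ω T : ℝ) (f g : ℝ → ℂ) (p : ℝ × ℝ) : ℝ :=
  (∫ x in (0 : ℝ)..T,
      ‖deriv f x - Complex.exp (Complex.I * ω * p.1) * deriv g (x - p.2)‖ ^ 2)
    + q * ∫ x in (0 : ℝ)..T, ‖f x - Complex.exp (Complex.I * ω * p.1) * g (x - p.2)‖ ^ 2

lemma orbitDist_nonneg (hT : 0 ≤ T) (f g : ℝ → ℂ) (p : ℝ × ℝ) : 0 ≤ orbitDist 1 ω T f g p :=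
  add_nonneg (intervalIntegral.integral_nonneg hT fun _ _ => by positivity)
    (mul_nonneg zero_le_one (intervalIntegral.integral_nonneg hT fun _ _ => by positivity))

lemma bddBelow_orbitDist (hT : 0 ≤ T) (f g : ℝ → ℂ) :
    BddBelow (range (orbitDist 1 ω T f g)) :=
  ⟨0, by rintro _ ⟨p, rfl⟩; exact orbitDist_nonneg hT f g p⟩

lemma dq_sq (hT : 0 ≤ T) (f g : ℝ → ℂ) :
    dq 1 ω T f g ^ 2 = ⨅ p, orbitDist 1 ω T f g p :=
  Real.sq_sqrt (Real.iInf_nonneg fun p => orbitDist_nonneg hT f g p)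

/-- Up to constants, `orbitDist` is the squared `H¹` norm of `h + i k`. -/
lemma orbitDist_bounds (hr : IsProfile a c T r) (hω : ∃ N : ℤ, ω * T = 2 * Real.pi * N)
    (hf : ContDiff ℝ 1 f) (hp : Function.Periodic f T) (t : ℝ) {θ z η ξ τ : ℝ}
    (hθ : θ = ω * τ) (hτ : τ = η - ξ + (3 * a + ω ^ 2) * t) (hz : z = ξ - (a + 3 * ω ^ 2) * t)
    {h k : PerC1 T} (hh : h = rotRe θ z (demodRe hω hf hp) (demodIm hω hf hp) - hr.toPerC1)
    (hk : k = rotIm θ z (demodRe hω hf hp) (demodIm hω hf hp)) :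
    l2Form T h h + l2Form T k k ≤ orbitDist 1 ω T f (wave a ω r t) (η, ξ) ∧
      orbitDist 1 ω T f (wave a ω r t) (η, ξ) ≤ (3 + 2 * ω ^ 2) * (h1Sq h + h1Sq k) := by
  have hT := hr.pos
  have hh0 := PerC1.continuous h; have hh1 := PerC1.continuous_deriv h
  have hk0 := PerC1.continuous k; have hk1 := PerC1.continuous_deriv k
  have hsub := sub_wave_eq hr hω hf hp t hθ hτ hz
  rw [← hh, ← hk] at hsub
  have hderiv : ∀ x, deriv f x - Complex.exp (Complex.I * ω * η) * deriv (wave a ω r t) (x - ξ) =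
      Complex.exp (Complex.I * ω * (x + τ : ℝ)) *
        (((deriv h.1 (x + -z) - ω * k.1 (x + -z) : ℝ) : ℂ) +
          ((deriv k.1 (x + -z) + ω * h.1 (x + -z) : ℝ) : ℂ) * Complex.I) := by
    intro x
    rw [← (hasDerivAt_exp_mul_pair h k ω τ (-z) x).deriv, ← funext hsub]
    have h1 := (hf.differentiable one_ne_zero x).hasDerivAt
    have h2 := (((contDiff_wave (ω := ω) hr t).differentiable one_ne_zero
      (x - ξ)).hasDerivAt.comp_sub_const x ξ).const_mul (Complex.exp (Complex.I * ω * η))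
    exact (h1.sub h2).deriv.symm
  have i2 : ∫ x in (0 : ℝ)..T,
      ‖f x - Complex.exp (Complex.I * ω * η) * wave a ω r t (x - ξ)‖ ^ 2 =
      ∫ x in (0 : ℝ)..T, (h.1 x ^ 2 + k.1 x ^ 2) := by
    refine Eq.trans ?_ (integral_comp_add_of_periodic (fun x => ?_) (-z))
    · refine intervalIntegral.integral_congr fun x _ => ?_
      simp only [hsub, sq_norm_exp_mul]
    · simp only [PerC1.periodic h x, PerC1.periodic k x]
  have i1 : ∫ x in (0 : ℝ)..T,
      ‖deriv f x - Complex.exp (Complex.I * ω * η) * deriv (wave a ω r t) (x - ξ)‖ ^ 2 =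
      ∫ x in (0 : ℝ)..T, ((deriv h.1 x - ω * k.1 x) ^ 2 + (deriv k.1 x + ω * h.1 x) ^ 2) := by
    refine Eq.trans ?_ (integral_comp_add_of_periodic (fun x => ?_) (-z))
    · refine intervalIntegral.integral_congr fun x _ => ?_
      simp only [hderiv, sq_norm_exp_mul]
    · simp only [PerC1.periodic h x, PerC1.periodic k x, PerC1.periodic_deriv h x,
        PerC1.periodic_deriv k x]
  have e : orbitDist 1 ω T f (wave a ω r t) (η, ξ) =
      (∫ x in (0 : ℝ)..T, ((deriv h.1 x - ω * k.1 x) ^ 2 + (deriv k.1 x + ω * h.1 x) ^ 2)) +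
      ∫ x in (0 : ℝ)..T, (h.1 x ^ 2 + k.1 x ^ 2) := by
    rw [orbitDist, i1, i2, one_mul]
  rw [e]
  constructor
  · have h1 : l2Form T h h + l2Form T k k = ∫ x in (0 : ℝ)..T, (h.1 x ^ 2 + k.1 x ^ 2) := by
      rw [l2Form_apply, l2Form_apply, ← intervalIntegral.integral_add
        (Continuous.intervalIntegrable (by fun_prop) _ _)
        (Continuous.intervalIntegrable (by fun_prop) _ _)]
      exact intervalIntegral.integral_congr fun x _ => by ring
    rw [h1]
    exact le_add_of_nonneg_left (intervalIntegral.integral_nonneg hT.le fun _ _ => by positivity)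
  · rw [h1Sq, h1Sq, ← intervalIntegral.integral_add
      (Continuous.intervalIntegrable (by fun_prop) _ _)
      (Continuous.intervalIntegrable (by fun_prop) _ _),
      ← intervalIntegral.integral_add (Continuous.intervalIntegrable (by fun_prop) _ _)
      (Continuous.intervalIntegrable (by fun_prop) _ _), ← intervalIntegral.integral_const_mul]
    refine intervalIntegral.integral_mono_on hT.le
      (Continuous.intervalIntegrable (by fun_prop) _ _)
      (Continuous.intervalIntegrable (by fun_prop) _ _) fun x _ => ?_
    generalize deriv h.1 x = p
    generalize deriv k.1 x = q
    generalize h.1 x = s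
    generalize k.1 x = w
    nlinarith [sq_nonneg (p + ω * w), sq_nonneg (q - ω * s), sq_nonneg p, sq_nonneg q,
      mul_nonneg (sq_nonneg ω) (sq_nonneg p), mul_nonneg (sq_nonneg ω) (sq_nonneg q),
      sq_nonneg s, sq_nonneg w]

end wave

end CMKdV

theorem proposition4p2 (a c T ω : ℝ) (r : ℝ → ℝ)
    (ha : a < 0) (hc₀ : -(a ^ 2 / 4) < c) (hc₁ : c < 0) (hT : 0 < T)
    (hr : CMKdV.IsProfile a c T r)
    (hω : ω ≠ 0) (hωT : ∃ N : ℤ, ω * T = 2 * Real.pi * N) :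
    ∃ m > 0, ∃ q > 0, ∃ δ₀ > 0,
      ∀ s > (3 / 2 : ℝ), ∀ t₀ > 0, ∀ u : ℝ → ℝ → ℂ, CMKdV.IsSolution hT s t₀ u →
        ∀ t ∈ Set.Ico 0 t₀,
          CMKdV.P T (u t) = CMKdV.P T (CMKdV.wave a ω r t) →
          CMKdV.dq q ω T (u t) (CMKdV.wave a ω r t) < δ₀ →
          CMKdV.M a ω T (u t) - CMKdV.M a ω T (CMKdV.wave a ω r t) ≥
            m * CMKdV.dq q ω T (u t) (CMKdV.wave a ω r t) ^ 2 := by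
  obtain ⟨m, hm, δ, hδ, H⟩ := hr.exists_orbital_lower_bound ha hc₀ hc₁
  refine ⟨m / (3 + 2 * ω ^ 2), by positivity, 1, one_pos, √δ, Real.sqrt_pos.2 hδ, ?_⟩
  intro s hs t₀ _ u hu t ht hP hd
  have hf := hu.contDiff hs ht
  have hp := hu.periodic t ht
  rw [CMKdV.P_eq hωT hf hp, CMKdV.P_wave hr hωT] at hP
  -- a point of the orbit which is close to `u(·, t)`
  obtain ⟨⟨η, ξ⟩, hηξ⟩ : ∃ p, CMKdV.orbitDist 1 ω T (u t) (CMKdV.wave a ω r t) p < δ := by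
    refine exists_lt_of_ciInf_lt ?_
    rw [← CMKdV.dq_sq hT.le, ← Real.sq_sqrt hδ.le]
    exact pow_lt_pow_left₀ hd (Real.sqrt_nonneg _) two_ne_zero
  obtain ⟨θ, z, hθz⟩ := H _ _ hP ⟨_, _,
    ((CMKdV.orbitDist_bounds hr hωT hf hp t (η := η) (ξ := ξ) rfl rfl rfl rfl rfl).1.trans
      hηξ.le)⟩
  -- the point of the orbit that corresponds to the phase `θ` and the translation `z`
  have hb := (CMKdV.orbitDist_bounds hr hωT hf hp t (θ := θ) (z := z)
    (η := θ / ω + (z + (a + 3 * ω ^ 2) * t) - (3 * a + ω ^ 2) * t)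
    (ξ := z + (a + 3 * ω ^ 2) * t) (τ := θ / ω) (by field_simp) (by ring) (by ring) rfl rfl).2
  rw [CMKdV.M_eq hωT hf hp, CMKdV.M_wave hr hωT, CMKdV.dq_sq hT.le]
  refine le_trans ?_ hθz
  have h1 := (ciInf_le (CMKdV.bddBelow_orbitDist hT.le (u t) (CMKdV.wave a ω r t)) _).trans hb
  calc m / (3 + 2 * ω ^ 2) * _ ≤ m / (3 + 2 * ω ^ 2) * _ :=
        mul_le_mul_of_nonneg_left h1 (by positivity)
    _ = _ := by field_simp
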